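/- All graphs are finite and simple. For a graph $G$ and a graph $H$, let $E'_H(G)$ denote the minimum number of edges whose removal from $G$ leaves an $H$-free graph (one containing no copy of $H$ as a not necessarily induced subgraph), and for an integer $r\ge 1$ let $E'_r(G)$ denote the minimum number of edges whose removal from $G$ leaves an $r$-partite (i.e. $r$-colourable) graph. Theorem. Let $H$ be a graph of chromatic number $r+1\ge 3$. (i) If there is an edge of $H$ whose removal reduces its chromatic number, then there is a constant $\mu=\mu(H)>0$ such that for every $n$ and every graph $G$ on $n$ vertices of minimum degree at least $(1-\mu)n$, $$E'_H(G)=E'_r(G).$$ (ii) Otherwise, there are constants $\gamma=\gamma(H)>0$, $\mu=\mu(H)>0$ and $C=C(H)$ such that for every $n$ and every graph $G$ on $n$ vertices of minimum degree at least $(1-\mu)n$, $$E'_r(G)-C\,n^{2-\gamma}\le E'_H(G)\le E'_r(G).$$ -/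

import Mathlib

universe u v

namespace SimpleGraph

/-- The least number of edges whose removal turns `G` into a graph satisfying `P`.
(If no edge deletion works the value is the junk value `0`; the lemmas below show that this
does not happen for the two properties to which it is applied.) -/
noncomputable def editDist {V : Type*} (P : SimpleGraph V → Prop) (G : SimpleGraph V) : ℕ :=
  sInf {k : ℕ | ∃ S : Finset (Sym2 V),
    (S : Set (Sym2 V)) ⊆ G.edgeSet ∧ S.card = k ∧ P (G.deleteEdges (S : Set (Sym2 V)))}

/-- The least number of edges whose removal makes `G` free of (not necessarily induced)
copies of `H`. -/
noncomputable def editDistFree {V W : Type*} (H : SimpleGraph W) (G : SimpleGraph V) : ℕ :=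
  editDist (fun G' => H.Free G') G

/-- The least number of edges whose removal makes `G` into an `r`-partite
(that is, `r`-colorable) graph. -/
noncomputable def editDistColorable {V : Type*} (r : ℕ) (G : SimpleGraph V) : ℕ :=
  editDist (fun G' => G'.Colorable r) G

/-- Some edge of `H` has the property that its removal reduces the chromatic number. -/
def HasCriticalEdge {W : Type*} (H : SimpleGraph W) : Prop :=
  ∃ e ∈ H.edgeSet, (H.deleteEdges {e}).chromaticNumber < H.chromaticNumber

/-- If the edgeless graph satisfies `P`, then `editDist P G` is attained. -/
theorem editDist_spec {V : Type*} [Finite V] (P : SimpleGraph V → Prop) (hP : P ⊥)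
    (G : SimpleGraph V) : ∃ S : Finset (Sym2 V), (S : Set (Sym2 V)) ⊆ G.edgeSet ∧
      S.card = editDist P G ∧ P (G.deleteEdges (S : Set (Sym2 V))) := by
  have hne : {k : ℕ | ∃ S : Finset (Sym2 V), (S : Set (Sym2 V)) ⊆ G.edgeSet ∧ S.card = k ∧
      P (G.deleteEdges (S : Set (Sym2 V)))}.Nonempty := by
    refine ⟨_, (Set.toFinite G.edgeSet).toFinset, by simp, rfl, ?_⟩
    simpa using hP
  exact Nat.sInf_mem hne

/-- The edgeless graph is `r`-colorable for `r ≥ 1`. -/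
theorem bot_colorable_of_pos {V : Type*} {r : ℕ} (hr : 1 ≤ r) :
    (⊥ : SimpleGraph V).Colorable r :=
  ⟨Coloring.mk (fun _ => (⟨0, hr⟩ : Fin r)) (by simp)⟩

/-- The edgeless graph is free of every graph that is not `1`-colorable. -/
theorem free_bot_of_not_colorable {V W : Type*} {H : SimpleGraph W} (hH : ¬ H.Colorable 1) :
    H.Free (⊥ : SimpleGraph V) := by
  rintro ⟨f⟩
  exact hH ((bot_colorable_of_pos le_rfl).of_hom f.toHom)

end SimpleGraph

/-! Let `Γ` be an `H`-free subgraph of `G` with the most edges. It suffices to find an `r`-cut of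
`G` with as many edges as `Γ`, up to the allowed error. An `r`-cut is itself `H`-free, so `Γ` has at
least a fraction 1 - 1/r of the edges of `G`. Peel off vertices whose `Γ`-degree in the current set
U is below (1 - 1/r - ε)|U|. Density makes this stop at a set of linear size on which `Γ` is
`H`-free with large minimum degree, and a structure theorem partitions that set into r parts with
few edges of `Γ` inside. Peeled vertices are put back in reverse order, each into a part holding at
most 1/r of its neighbours. As `G` is almost complete, each gains at least as many cut edges as its
removal cost `Γ` (`exists_cut_of_core`, `exists_editDistColorable_le_editDistFree_add`).

For the structure theorem, an `H`-free graph has no complete (r+1)-partite subgraph with parts of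
size h = |W|. Erdős–Stone gives a large complete r-partite subgraph. Boundedly many vertices have h
neighbours in each of its parts. Counting non-adjacencies shows that almost every other vertex
misses nearly all of one part and little of the others; sorting by the missed part yields
`BlowupFree.exists_near_complete_parts`. In general, the monochromatic edges outside a bounded
vertex set then contain no K_{h,h}, so Kővári–Sós–Turán bounds them
(`BlowupFree.exists_few_monochromatic`). If `H` has a critical edge, even one monochromatic edge
extends greedily to a copy of `H`, so there is none (`colorable_of_free_of_critical`). -/

namespace SimpleGraph

open Finset

open scoped Classical

/-! ### Blow-ups, greedy embedding and common neighbourhoods. -/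

section Blowup

variable {V : Type*} {W : Type*} {ι : Type*}

/-- The sets `A i` are pairwise completely joined in `F`. -/
def IsBlowup (F : SimpleGraph V) (A : ι → Finset V) : Prop :=
  ∀ i j, i ≠ j → ∀ a ∈ A i, ∀ b ∈ A j, F.Adj a b

/-- `F` contains no complete multipartite graph with `r + 1` parts of size `h`. -/
def BlowupFree (r h : ℕ) (F : SimpleGraph V) : Prop :=
  ∀ A : Option (Fin r) → Finset V, F.IsBlowup A → ∃ i, #(A i) < h

theorem IsBlowup.isContained [Fintype W] {F : SimpleGraph V} {H : SimpleGraph W}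
    {A : ι → Finset V} (hA : F.IsBlowup A) (c : H.Coloring ι)
    (hcard : ∀ i, Fintype.card W ≤ #(A i)) : H ⊑ F := by
  have hemb : ∀ i, ∃ g : W → V, Function.Injective g ∧ ∀ x, g x ∈ A i := by
    intro i
    have : Nonempty (W ↪ A i) := by
      rw [Function.Embedding.nonempty_iff_card_le]
      simpa using hcard i
    obtain ⟨g⟩ := this
    exact ⟨fun x => g x, fun x y hxy => g.injective (Subtype.ext hxy), fun x => (g x).2⟩
  choose g hg hgA using hemb
  refine ⟨⟨⟨fun x => g (c x) x, ?_⟩, ?_⟩⟩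
  · intro x y hxy
    exact hA _ _ (c.valid hxy) _ (hgA _ _) _ (hgA _ _)
  · intro x y hxy
    change g (c x) x = g (c y) y at hxy
    by_cases hc : c x = c y
    · rw [hc] at hxy
      exact hg _ hxy
    · have h := hA _ _ hc _ (hgA (c x) x) _ (hgA (c y) y)
      rw [hxy] at h
      exact absurd h (F.irrefl)

/-- An (r+1)-colouring lets `H` be placed class by class in a blow-up whose parts have |W| vertices.
-/
theorem Free.blowupFree [Fintype W] {F : SimpleGraph V} {H : SimpleGraph W} {r : ℕ}
    (hF : H.Free F) (hH : H.Colorable (r + 1)) : F.BlowupFree r (Fintype.card W) := by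
  intro A hA
  by_contra! hcon
  have c : H.Coloring (Option (Fin r)) := hH.toColoring (by simp)
  exact hF (hA.isContained c hcon)

/-- Vertices can be embedded greedily into almost completely joined sets. -/
theorem exists_greedy_embedding [Nonempty V] {F : SimpleGraph V} {B : ι → Finset V} {κ : ℝ}
    (hκ : 0 ≤ κ)
    (hB : ∀ i j, i ≠ j → ∀ a ∈ B i, (#{b ∈ B j | ¬ F.Adj a b} : ℝ) ≤ κ)
    (col : W → ι) (s : Finset W) (hs : ∀ i, (#s : ℝ) * (κ + 1) ≤ #(B i)) :
    ∃ φ : W → V, (∀ x ∈ s, φ x ∈ B (col x)) ∧ Set.InjOn φ s ∧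
      ∀ x ∈ s, ∀ y ∈ s, col x ≠ col y → F.Adj (φ x) (φ y) := by
  induction s using Finset.induction_on with
  | empty =>
    exact ⟨fun _ => Classical.arbitrary V, by simp, by simp, by simp⟩
  | insert x s hx ih =>
    rw [card_insert_of_notMem hx] at hs
    push_cast at hs
    obtain ⟨φ, h1, h2, h3⟩ := ih fun i => by nlinarith [hs i]
    -- Each placed vertex forbids its own image and, if its colour differs from that of `x`, at most
    -- `κ` non-neighbours; this is the factor `κ + 1`.
    set bad : Finset V := s.biUnion fun y =>
      insert (φ y) {b ∈ B (col x) | col y ≠ col x ∧ ¬ F.Adj (φ y) b} with hbad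
    have hcard : (#bad : ℝ) ≤ #s * (κ + 1) := by
      have : (#bad : ℝ) ≤ ∑ y ∈ s,
          (#(insert (φ y) {b ∈ B (col x) | col y ≠ col x ∧ ¬ F.Adj (φ y) b}) : ℝ) := by
        exact_mod_cast card_biUnion_le
      refine this.trans ?_
      rw [← nsmul_eq_mul, ← sum_const]
      refine sum_le_sum fun y hy => ?_
      refine (Nat.cast_le.2 (card_insert_le _ _)).trans ?_
      push_cast
      gcongr
      by_cases hc : col y = col x
      · simpa [hc] using hκ
      · simpa [hc] using hB _ _ hc _ (h1 y hy)
    have hlt : #bad < #(B (col x)) := by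
      have : (#bad : ℝ) < #(B (col x)) := by nlinarith [hs (col x)]
      exact_mod_cast this
    obtain ⟨b, hb, hbn⟩ := exists_mem_notMem_of_card_lt_card hlt
    have hbn' : ∀ y ∈ s, b ≠ φ y ∧ (col y ≠ col x → F.Adj (φ y) b) := by
      intro y hy
      simp only [hbad, mem_biUnion, mem_insert, mem_filter, not_exists, not_and, not_or] at hbn
      have := hbn y hy
      refine ⟨this.1, fun hc => ?_⟩
      by_contra hn
      exact this.2 hb hc hn
    have hne : ∀ y ∈ s, y ≠ x := fun y hy h => hx (h ▸ hy)
    refine ⟨Function.update φ x b, ?_, ?_, ?_⟩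
    · intro y hy
      rcases mem_insert.1 hy with rfl | hy
      · simpa using hb
      · simpa [hne y hy] using h1 y hy
    · intro y hy z hz hyz
      rcases mem_insert.1 hy with rfl | hy' <;> rcases mem_insert.1 hz with rfl | hz'
      · rfl
      · simp only [Function.update_self, Function.update_of_ne (hne z hz')] at hyz
        exact absurd hyz (hbn' z hz').1
      · simp only [Function.update_self, Function.update_of_ne (hne y hy')] at hyz
        exact absurd hyz.symm (hbn' y hy').1
      · simp only [Function.update_of_ne (hne z hz'), Function.update_of_ne (hne y hy')] at hyz
        exact h2 hy' hz' hyz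
    · intro y hy z hz hc
      rcases mem_insert.1 hy with rfl | hy' <;> rcases mem_insert.1 hz with rfl | hz'
      · exact absurd rfl hc
      · simp only [Function.update_self, Function.update_of_ne (hne z hz')]
        exact ((hbn' z hz').2 hc.symm).symm
      · simp only [Function.update_self, Function.update_of_ne (hne y hy')]
        exact (hbn' y hy').2 hc
      · simp only [Function.update_of_ne (hne z hz'), Function.update_of_ne (hne y hy')]
        exact h3 y hy' z hz' hc

/-- Greedy embedding of the pairs (i, k), coloured by i. -/
theorem exists_isBlowup_of_almost_joined [Fintype ι] [Nonempty V] {F : SimpleGraph V}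
    {B : ι → Finset V} {κ : ℝ} (hκ : 0 ≤ κ)
    (hB : ∀ i j, i ≠ j → ∀ a ∈ B i, (#{b ∈ B j | ¬ F.Adj a b} : ℝ) ≤ κ) (h : ℕ)
    (hs : ∀ i, (Fintype.card ι * h : ℝ) * (κ + 1) ≤ #(B i)) :
    ∃ A : ι → Finset V, F.IsBlowup A ∧ ∀ i, A i ⊆ B i ∧ #(A i) = h := by
  obtain ⟨φ, h1, h2, h3⟩ := exists_greedy_embedding hκ hB (Prod.fst : ι × Fin h → ι) univ
    (by simpa using hs)
  refine ⟨fun i => univ.image fun k : Fin h => φ (i, k), ?_, fun i => ⟨?_, ?_⟩⟩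
  · intro i j hij a ha b hb
    simp only [mem_image, mem_univ, true_and] at ha hb
    obtain ⟨k, rfl⟩ := ha
    obtain ⟨l, rfl⟩ := hb
    exact h3 _ (mem_univ _) _ (mem_univ _) hij
  · intro a ha
    simp only [mem_image, mem_univ, true_and] at ha
    obtain ⟨k, rfl⟩ := ha
    exact h1 (i, k) (mem_univ _)
  · rw [card_image_of_injective, card_univ, Fintype.card_fin]
    intro k l hkl
    have := h2 (by simp) (by simp) hkl
    simpa using this

/-- Few non-neighbours give many common neighbours. -/
theorem card_sub_le_card_common {F : SimpleGraph V} {U S : Finset V} {κ : ℝ}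
    (hS : ∀ v ∈ S, (#{u ∈ U | ¬ F.Adj v u} : ℝ) ≤ κ) :
    (#U : ℝ) - #S * κ ≤ #{u ∈ U | ∀ v ∈ S, F.Adj v u} := by
  have h1 : (#U : ℝ) ≤ #{u ∈ U | ∀ v ∈ S, F.Adj v u} +
      #(S.biUnion fun v => {u ∈ U | ¬ F.Adj v u}) := by
    rw [← Nat.cast_add, Nat.cast_le]
    refine (card_le_card ?_).trans (card_union_le _ _)
    intro u hu
    by_cases h : ∀ v ∈ S, F.Adj v u
    · exact mem_union_left _ (mem_filter.2 ⟨hu, h⟩)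
    · push Not at h
      obtain ⟨v, hv, hn⟩ := h
      exact mem_union_right _ (mem_biUnion.2 ⟨v, hv, mem_filter.2 ⟨hu, hn⟩⟩)
  have h2 : (#(S.biUnion fun v => {u ∈ U | ¬ F.Adj v u}) : ℝ) ≤ #S * κ := by
    rw [← nsmul_eq_mul, ← sum_const]
    refine le_trans ?_ (sum_le_sum hS)
    exact_mod_cast card_biUnion_le
  linarith

/-- A blow-up together with many vertices attached to all of its parts yields a blow-up with one
more part. -/
theorem IsBlowup.exists_option [Fintype ι] {F : SimpleGraph V} {A : ι → Finset V}
    (hA : F.IsBlowup A) {t : ℕ} {Q : Finset V}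
    (hQ : ∀ v ∈ Q, ∀ i, t ≤ #{a ∈ A i | F.Adj v a})
    (hcard : 2 ^ #(univ.biUnion A) * t ≤ #Q) (ht : 0 < t) :
    ∃ A' : Option ι → Finset V, F.IsBlowup A' ∧ ∀ i, t ≤ #(A' i) := by
  -- Pigeonhole over the possible traces on the blow-up: `t` vertices of `Q` share one trace `S`,
  -- which meets every part in at least `t` vertices.
  obtain ⟨S, -, hS⟩ := exists_le_card_fiber_of_mul_le_card_of_maps_to
    (s := Q) (t := (univ.biUnion A).powerset)
    (f := fun v => {a ∈ univ.biUnion A | F.Adj v a}) (n := t)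
    (by intro a _; simp) ⟨∅, by simp⟩ (by simpa using hcard)
  set Q' := {x ∈ Q | ({a ∈ univ.biUnion A | F.Adj x a} : Finset V) = S} with hQ'
  have hadj : ∀ v ∈ Q', ∀ a ∈ S, F.Adj v a := by
    intro v hv a ha
    rw [← (mem_filter.1 hv).2] at ha
    exact (mem_filter.1 ha).2
  refine ⟨fun o => o.elim Q' fun i => A i ∩ S, ?_, ?_⟩
  · rintro (_ | i) (_ | j) hij a ha b hb
    · exact absurd rfl hij
    · exact hadj _ ha _ (mem_inter.1 hb).2
    · exact (hadj _ hb _ (mem_inter.1 ha).2).symm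
    · exact hA i j (fun h => hij (by rw [h])) _ (mem_inter.1 ha).1 _ (mem_inter.1 hb).1
  · rintro (_ | i)
    · exact hS
    · obtain ⟨v, hv⟩ := card_pos.1 (ht.trans_le hS)
      refine (hQ v (mem_filter.1 hv).1 i).trans (card_le_card ?_)
      intro a ha
      obtain ⟨ha1, ha2⟩ := mem_filter.1 ha
      refine mem_inter.2 ⟨ha1, ?_⟩
      rw [← (mem_filter.1 hv).2]
      exact mem_filter.2 ⟨mem_biUnion.2 ⟨i, mem_univ _, ha1⟩, ha2⟩

/-- A complete bipartite pair completely joined to all but one of the parts of a blow-up. -/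
theorem BlowupFree.false_of_pair {r h : ℕ} {F : SimpleGraph V} (hF : F.BlowupFree r h) (i : Fin r)
    {B : Fin r → Finset V} (hB : ∀ j k, j ≠ i → k ≠ i → j ≠ k → ∀ a ∈ B j, ∀ b ∈ B k, F.Adj a b)
    (hBc : ∀ j, j ≠ i → h ≤ #(B j)) {S T : Finset V} (hS : h ≤ #S) (hT : h ≤ #T)
    (hST : ∀ s ∈ S, ∀ t ∈ T, F.Adj s t)
    (hSB : ∀ s ∈ S, ∀ j, j ≠ i → ∀ b ∈ B j, F.Adj s b)
    (hTB : ∀ s ∈ T, ∀ j, j ≠ i → ∀ b ∈ B j, F.Adj s b) : False := by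
  have hbl : F.IsBlowup fun o : Option (Fin r) => o.elim S fun j => if j = i then T else B j := by
    rintro (_ | j) (_ | k) hjk a ha b hb
    · exact absurd rfl hjk
    · by_cases hk : k = i
      · simp only [Option.elim, hk, if_true] at ha hb
        exact hST _ ha _ hb
      · simp only [Option.elim, hk, if_false] at ha hb
        exact hSB _ ha _ hk _ hb
    · by_cases hj : j = i
      · simp only [Option.elim, hj, if_true] at ha hb
        exact (hST _ hb _ ha).symm
      · simp only [Option.elim, hj, if_false] at ha hb
        exact (hSB _ hb _ hj _ ha).symm
    · have hjk' : j ≠ k := fun h => hjk (by rw [h])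
      by_cases hj : j = i <;> by_cases hk : k = i
      · exact absurd (hj.trans hk.symm) hjk'
      · simp only [Option.elim, hj, hk, if_true, if_false] at ha hb
        exact hTB _ ha _ hk _ hb
      · simp only [Option.elim, hj, hk, if_true, if_false] at ha hb
        exact (hTB _ hb _ hj _ ha).symm
      · simp only [Option.elim, hj, hk, if_false] at ha hb
        exact hB _ _ hj hk hjk' _ ha _ hb
  obtain ⟨o, ho⟩ := hF _ hbl
  rcases o with _ | j
  · simp only [Option.elim] at ho
    omega
  · by_cases hj : j = i
    · simp only [Option.elim, hj, if_true] at ho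
      omega
    · simp only [Option.elim, hj, if_false] at ho
      have := hBc j hj
      omega

/-- Among many vertices with linearly many neighbours in `U`, some `k` have linearly many
common neighbours in `U`. -/
theorem exists_common_neighbors (k : ℕ) {c : ℝ} (hc : 0 < c) :
    ∃ N : ℕ, ∃ κ : ℝ, 0 < κ ∧ ∀ (V : Type v) [Fintype V] (F : SimpleGraph V) (U Y : Finset V),
      N ≤ #Y → (∀ y ∈ Y, c * Fintype.card V ≤ #{u ∈ U | F.Adj y u}) →
      ∃ Y' ⊆ Y, #Y' = k ∧ κ * Fintype.card V ≤ #{u ∈ U | ∀ y ∈ Y', F.Adj y u} := by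
  -- With 2k ≤ Nc, vertices of `U` having fewer than k neighbours in `Y` account for at most half of
  -- the Ncm adjacencies, so `U'` has at least cm/2 vertices. Pigeonhole over at most 2^N traces on
  -- `Y` then fixes k common neighbours.
  set N := ⌈2 * k / c⌉₊ + k + 1 with hN
  refine ⟨N, c / 2 / 2 ^ N, by positivity, fun V _ F U Y0 hY0 hY => ?_⟩
  obtain ⟨Y, hYY, hYc⟩ := exists_subset_card_eq hY0
  set m : ℝ := (Fintype.card V : ℝ) with hm
  have hm0 : 0 ≤ m := by positivity
  have hNk : 2 * (k : ℝ) ≤ N * c := by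
    have h1 : 2 * k / c ≤ N := (Nat.le_ceil _).trans (by
      rw [hN]; push_cast; linarith [k.cast_nonneg (α := ℝ)])
    rwa [div_le_iff₀ hc] at h1
  set U' := {u ∈ U | k ≤ #{y ∈ Y | F.Adj y u}} with hU'
  have hsum1 : (N : ℝ) * (c * m) ≤ ∑ y ∈ Y, (#{u ∈ U | F.Adj y u} : ℝ) := by
    rw [← hYc, ← nsmul_eq_mul, ← sum_const]
    exact sum_le_sum fun y hy => hY y (hYY hy)
  have hsum2 : ∑ y ∈ Y, (#{u ∈ U | F.Adj y u} : ℝ) = ∑ u ∈ U, (#{y ∈ Y | F.Adj y u} : ℝ) := by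
    exact_mod_cast sum_card_bipartiteAbove_eq_sum_card_bipartiteBelow (s := Y) (t := U) F.Adj
  have hsum3 : ∑ u ∈ U, (#{y ∈ Y | F.Adj y u} : ℝ) ≤ #U' * N + m * k := by
    have h1 : ∀ u ∈ U, (#{y ∈ Y | F.Adj y u} : ℝ) ≤ (if u ∈ U' then (N : ℝ) else 0) + k := by
      intro u hu
      split_ifs with h
      · have : #{y ∈ Y | F.Adj y u} ≤ N := hYc ▸ card_filter_le _ _
        have : (#{y ∈ Y | F.Adj y u} : ℝ) ≤ N := by exact_mod_cast this
        linarith [k.cast_nonneg (α := ℝ)]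
      · have : ¬ k ≤ #{y ∈ Y | F.Adj y u} := fun h' => h (mem_filter.2 ⟨hu, h'⟩)
        have : (#{y ∈ Y | F.Adj y u} : ℝ) ≤ k := by exact_mod_cast (not_le.1 this).le
        linarith
    refine (sum_le_sum h1).trans ?_
    rw [sum_add_distrib, sum_const, nsmul_eq_mul, ← sum_filter, sum_const, nsmul_eq_mul]
    have h2 : ({a ∈ U | a ∈ U'} : Finset V) = U' := by
      ext a; simp [hU']
    rw [h2]
    gcongr
    rw [hm]
    exact_mod_cast card_le_univ U
  have hU'c : c / 2 * m ≤ #U' := by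
    have hNpos : (0 : ℝ) < N := by rw [hN]; positivity
    have : (N : ℝ) * (c / 2 * m) ≤ N * #U' := by nlinarith
    exact le_of_mul_le_mul_left this hNpos
  obtain ⟨S, hS, hSc⟩ := exists_le_card_fiber_of_nsmul_le_card_of_maps_to
    (s := U') (t := {S ∈ Y.powerset | k ≤ #S}) (f := fun u => {y ∈ Y | F.Adj y u})
    (b := c / 2 / 2 ^ N * m)
    (by intro u hu; simpa using (mem_filter.1 hu).2)
    ⟨Y, by simp only [mem_filter, mem_powerset, subset_refl, true_and]; omega⟩
    (by
      rw [nsmul_eq_mul]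
      have : (#{S ∈ Y.powerset | k ≤ #S} : ℝ) ≤ 2 ^ N := by
        rw [← hYc]
        exact_mod_cast (card_filter_le _ _).trans (card_powerset Y).le
      calc _ ≤ (2 : ℝ) ^ N * (c / 2 / 2 ^ N * m) := by gcongr
        _ = c / 2 * m := by field_simp
        _ ≤ _ := hU'c)
  obtain ⟨hSY, hSk⟩ := mem_filter.1 hS
  obtain ⟨Y', hY'S, hY'c⟩ := exists_subset_card_eq hSk
  refine ⟨Y', hY'S.trans ((mem_powerset.1 hSY).trans hYY), hY'c, hSc.trans ?_⟩
  gcongr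
  intro u hu
  simp only [mem_filter] at hu ⊢
  refine ⟨?_, fun y hy => ?_⟩
  · exact (mem_filter.1 hu.1).1
  · have := hY'S hy
    rw [← hu.2] at this
    exact (mem_filter.1 this).2

/-- The version of `exists_common_neighbors` for several target sets simultaneously. -/
theorem exists_common_neighbors_family (I : Finset ι) {c : ℝ} (hc : 0 < c) (k : ℕ) :
    ∃ N : ℕ, ∃ κ : ℝ, 0 < κ ∧ ∀ (V : Type v) [Fintype V] (F : SimpleGraph V) (U : ι → Finset V)
      (Y : Finset V), N ≤ #Y →
      (∀ y ∈ Y, ∀ i ∈ I, c * Fintype.card V ≤ #{u ∈ U i | F.Adj y u}) →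
      ∃ Y' ⊆ Y, #Y' = k ∧ ∀ i ∈ I,
        κ * Fintype.card V ≤ #{u ∈ U i | ∀ y ∈ Y', F.Adj y u} := by
  induction I using Finset.induction_on generalizing k with
  | empty =>
    refine ⟨k, 1, one_pos, fun V _ F U Y hY _ => ?_⟩
    obtain ⟨Y', h1, h2⟩ := exists_subset_card_eq hY
    exact ⟨Y', h1, h2, by simp⟩
  | insert i I hi ih =>
    -- The induction hypothesis is asked for `N₁` vertices, enough for the one-set version to select
    -- k of them; shrinking the selection only enlarges common neighbourhoods.
    obtain ⟨N₁, κ₁, hκ₁, h₁⟩ := exists_common_neighbors.{v} k hc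
    obtain ⟨N₂, κ₂, hκ₂, h₂⟩ := ih N₁
    refine ⟨N₂, min κ₁ κ₂, lt_min hκ₁ hκ₂, fun V _ F U Y hY hYc => ?_⟩
    obtain ⟨Y₂, hY₂, hY₂c, hY₂n⟩ := h₂ V F U Y hY fun y hy j hj => hYc y hy j (mem_insert_of_mem hj)
    obtain ⟨Y₁, hY₁, hY₁c, hY₁n⟩ := h₁ V F (U i) Y₂ hY₂c.ge
      fun y hy => hYc y (hY₂ hy) i (mem_insert_self _ _)
    refine ⟨Y₁, hY₁.trans hY₂, hY₁c, fun j hj => ?_⟩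
    rcases mem_insert.1 hj with rfl | hj
    · refine le_trans ?_ hY₁n
      gcongr
      exact min_le_left _ _
    · refine le_trans ?_ ((hY₂n j hj).trans ?_)
      · gcongr
        exact min_le_right _ _
      · refine Nat.cast_le.2 (card_le_card (monotone_filter_right _ ?_))
        exact fun u _ h y hy => h y (hY₁ hy)

end Blowup

/-! ### Structure of blow-up-free graphs with few non-neighbours. -/

theorem degree_add_card_not_adj {V : Type*} [Fintype V] (F : SimpleGraph V) (v : V) :
    (F.degree v : ℝ) + #{u | ¬ F.Adj v u} = Fintype.card V := by
  have h := card_filter_add_card_filter_not (s := (univ : Finset V)) (F.Adj v)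
  rw [card_univ] at h
  rw [← card_neighborFinset_eq_degree, neighborFinset_eq_filter]
  exact_mod_cast h

/-- The **Erdős–Stone theorem** for graphs in which all vertices have few non-neighbours. -/
theorem exists_isBlowup_of_card_not_adj_le {r : ℕ} (hr : 2 ≤ r) (t : ℕ) :
    ∃ m₀ : ℕ, ∀ (V : Type v) [Fintype V] (F : SimpleGraph V) (ε : ℝ),
      2 * ε ≤ 1 / (r * (r - 1)) → m₀ ≤ Fintype.card V →
      (∀ v, (#{u | ¬ F.Adj v u} : ℝ) ≤ (1 / r + ε) * Fintype.card V) →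
      ∃ A : Fin r → Finset V, F.IsBlowup A ∧ ∀ i, #(A i) = t := by
  obtain ⟨s, rfl⟩ : ∃ s, r = s + 1 := ⟨r - 1, by omega⟩
  have hs : (1 : ℝ) ≤ s := by exact_mod_cast (by omega : 1 ≤ s)
  -- Since 1/s = 1/(s+1) + 2ε₀ and ε ≤ ε₀, the minimum degree exceeds the Erdős–Stone threshold 1 -
  -- 1/s by ε₀.
  set ε₀ : ℝ := 1 / (((s + 1 : ℕ) : ℝ) * (((s + 1 : ℕ) : ℝ) - 1)) / 2 with hε₀
  have hpos : 0 < ε₀ := by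
    rw [hε₀]; push_cast
    have : (0 : ℝ) < s := by linarith
    rw [add_sub_cancel_right]
    positivity
  obtain ⟨m₀, hm₀⟩ := Filter.eventually_atTop.1
    (eventually_completeEquipartiteGraph_isContained_of_minDegree hpos s t)
  refine ⟨m₀ + 1, fun V _ F ε hε hm hF => ?_⟩
  have hne : Nonempty V := Fintype.card_pos_iff.1 (by omega)
  have hne' : Nonempty (Fin (Fintype.card V)) := ⟨⟨0, by omega⟩⟩
  have hmin : ((F.overFin rfl).minDegree : ℝ) ≥ (1 - 1 / s + ε₀) * Fintype.card V := by
    obtain ⟨x, hx⟩ := (F.overFin rfl).exists_minimal_degree_vertex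
    rw [hx]
    obtain ⟨y, rfl⟩ := (F.overFinIso rfl).surjective x
    rw [Iso.degree_eq]
    have h1 := degree_add_card_not_adj F y
    have h2 := hF y
    have h3 : (1 - 1 / (s : ℝ) + ε₀) + (1 / ((s + 1 : ℕ) : ℝ) + ε) ≤ 1 := by
      have : 1 / (s : ℝ) = 1 / ((s + 1 : ℕ) : ℝ) + 2 * ε₀ := by
        have hs0 : (s : ℝ) ≠ 0 := by linarith
        have hs1 : (s : ℝ) + 1 ≠ 0 := by linarith
        rw [hε₀]; push_cast; rw [add_sub_cancel_right]; field_simp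
      linarith
    have h4 : (0 : ℝ) ≤ Fintype.card V := by positivity
    nlinarith
  obtain ⟨f⟩ := (hm₀ _ (by omega) hmin).trans ⟨(F.overFinIso rfl).symm.toCopy⟩
  refine ⟨fun i => univ.image fun k : Fin t => f (i, k), ?_, fun i => ?_⟩
  · intro i j hij a ha b hb
    simp only [mem_image, mem_univ, true_and] at ha hb
    obtain ⟨k, rfl⟩ := ha
    obtain ⟨l, rfl⟩ := hb
    exact f.toHom.map_adj (by simpa [completeEquipartiteGraph_adj] using hij)
  · rw [card_image_of_injective, card_univ, Fintype.card_fin]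
    intro k l hkl
    simpa using f.injective hkl

/-- Double counting of non-adjacent pairs between a vertex set and `r` sets of size `t`. -/
theorem card_mul_add_card_mul_le {V : Type*} [Fintype V] {F : SimpleGraph V} {r t : ℕ} (hr : 0 < r)
    {h x ε m : ℝ} (hm : m = Fintype.card V) (hdeg : ∀ v, (#{u | ¬ F.Adj v u} : ℝ) ≤ (1 / r + ε) * m)
    {A : Fin r → Finset V} (hAt : ∀ i, #(A i) = t) {Q X : Finset V} {g : V → Fin r}
    (hg : ∀ v ∉ Q, (#{a ∈ A (g v) | F.Adj v a} : ℝ) ≤ h)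
    (hX : ∀ v ∈ X, v ∉ Q ∧ ∃ j, j ≠ g v ∧ x ≤ #{a ∈ A j | ¬ F.Adj v a}) :
    (m - #Q) * (t - h) + #X * x ≤ (1 + r * ε) * t * m := by
  have hnon : ∀ v i, (#{a ∈ A i | ¬ F.Adj v a} : ℝ) = t - #{a ∈ A i | F.Adj v a} := by
    intro v i
    have := card_filter_add_card_filter_not (s := A i) (F.Adj v)
    rw [hAt] at this
    rw [← this]; push_cast; ring
  have hup : ∑ v : V, ∑ i, (#{a ∈ A i | ¬ F.Adj v a} : ℝ) ≤ (1 + r * ε) * t * m := by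
    rw [sum_comm]
    have h1 : ∀ i, ∑ v : V, (#{a ∈ A i | ¬ F.Adj v a} : ℝ) ≤ t * ((1 / r + ε) * m) := by
      intro i
      have h2 : ∑ v : V, (#{a ∈ A i | ¬ F.Adj v a} : ℝ) =
          ∑ a ∈ A i, (#{v : V | ¬ F.Adj v a} : ℝ) := by
        exact_mod_cast sum_card_bipartiteAbove_eq_sum_card_bipartiteBelow
          (s := (univ : Finset V)) (t := A i) (fun v a => ¬ F.Adj v a)
      rw [h2, ← hAt i, ← nsmul_eq_mul, ← sum_const]
      refine sum_le_sum fun a _ => ?_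
      refine le_trans (le_of_eq ?_) (hdeg a)
      congr 2
      ext v
      rw [mem_filter, mem_filter, F.adj_comm]
    refine (sum_le_sum fun i _ => h1 i).trans (le_of_eq ?_)
    rw [sum_const, card_univ, Fintype.card_fin, nsmul_eq_mul]
    field_simp
  -- A vertex outside `Q` misses at least t - h vertices of its own part `A (g v)`; one in `X` also
  -- misses at least x in another part.
  have hlow : (m - #Q) * (t - h) + #X * x ≤
      ∑ v : V, ∑ i, (#{a ∈ A i | ¬ F.Adj v a} : ℝ) := by
    have h1 : ∀ v : V, (if v ∉ Q then (t - h : ℝ) else 0) + (if v ∈ X then x else 0) ≤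
        ∑ i, (#{a ∈ A i | ¬ F.Adj v a} : ℝ) := by
      intro v
      by_cases hv : v ∈ Q
      · have hvX : v ∉ X := fun h => (hX v h).1 hv
        rw [if_neg (not_not.2 hv), if_neg hvX, add_zero]
        exact sum_nonneg fun _ _ => Nat.cast_nonneg _
      · have h2 : (t - h : ℝ) ≤ #{a ∈ A (g v) | ¬ F.Adj v a} := by
          rw [hnon]
          linarith [hg v hv]
        by_cases hvX : v ∈ X
        · obtain ⟨j, hj, hjc⟩ := (hX v hvX).2
          rw [if_pos hv, if_pos hvX]
          calc (t - h : ℝ) + x ≤ ∑ i ∈ {g v, j}, (#{a ∈ A i | ¬ F.Adj v a} : ℝ) := by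
                rw [sum_pair hj.symm]; linarith
            _ ≤ _ := sum_le_sum_of_subset_of_nonneg (subset_univ _) fun _ _ _ => Nat.cast_nonneg _
        · simp only [hv, hvX, not_false_iff, if_true, if_false, add_zero]
          exact h2.trans (single_le_sum (f := fun i => (#{a ∈ A i | ¬ F.Adj v a} : ℝ))
            (fun _ _ => Nat.cast_nonneg _) (mem_univ (g v)))
    refine le_trans (le_of_eq ?_) (sum_le_sum fun v _ => h1 v)
    rw [sum_add_distrib, ← sum_filter, ← sum_filter, sum_const, sum_const, nsmul_eq_mul,
      nsmul_eq_mul]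
    have h3 : ({v | v ∈ X} : Finset V) = X := by ext; simp
    have h4 : (#({v | v ∉ Q} : Finset V) : ℝ) = m - #Q := by
      have : ({v | v ∉ Q} : Finset V) = Qᶜ := by ext; simp
      rw [this, card_compl, Nat.cast_sub (card_le_univ _), hm]
    rw [h3, h4]
  exact hlow.trans hup

/-- A blow-up-free graph whose vertices have few non-neighbours is close to `r`-partite: almost
all vertices lie in `r` sets that are internally sparse at every vertex. -/
theorem BlowupFree.exists_sparse_parts {r h : ℕ} (hr : 2 ≤ r) (hh : 1 ≤ h) {η : ℝ} (hη : 0 < η) :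
    ∃ ε : ℝ, 0 < ε ∧ ε ≤ η ∧ ∃ m₀ : ℕ, ∀ (V : Type v) [Fintype V] (F : SimpleGraph V),
      m₀ ≤ Fintype.card V → F.BlowupFree r h →
      (∀ v, (#{u | ¬ F.Adj v u} : ℝ) ≤ (1 / r + ε) * Fintype.card V) →
      ∃ P : Fin r → Finset V, (∀ i j, i ≠ j → Disjoint (P i) (P j)) ∧
        (1 - η) * Fintype.card V ≤ ∑ i, (#(P i) : ℝ) ∧
        ∀ i, ∀ v ∈ P i, (#{u ∈ P i | F.Adj v u} : ℝ) ≤ η * Fintype.card V := by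
  have hr' : (2 : ℝ) ≤ r := by exact_mod_cast hr
  have hr0 : (0 : ℝ) < r := by linarith
  have hh' : (1 : ℝ) ≤ h := by exact_mod_cast hh
  -- Any 2h vertices, each missing at most δt of a part, together miss at most t/2 and leave h
  -- common neighbours there.
  set δ : ℝ := 1 / (4 * h) with hδ
  have hδ0 : 0 < δ := by positivity
  -- Together with rε ≤ ηδ/8 this keeps the error h + rεt of the double count below ηδt/4, so `X`
  -- has at most ηm/4 + O(1) vertices.
  set t : ℕ := ⌈8 * h / (η * δ)⌉₊ + 2 * h with ht
  have ht1 : 8 * (h : ℝ) ≤ t * (η * δ) := by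
    rw [← div_le_iff₀ (by positivity)]
    refine (Nat.le_ceil _).trans ?_
    rw [ht]; push_cast; linarith
  have ht2 : 2 * (h : ℝ) ≤ t := by
    rw [ht]; push_cast
    linarith [(⌈8 * (h : ℝ) / (η * δ)⌉₊).cast_nonneg (α := ℝ)]
  have ht0 : (0 : ℝ) < t := by linarith
  set ε : ℝ := min (min η (η * δ / (8 * r))) (1 / (r * (r - 1)) / 2) with hε
  have hε0 : 0 < ε := by
    have : (0 : ℝ) < r - 1 := by linarith
    rw [hε]; positivity
  have hεη : ε ≤ η := (min_le_left _ _).trans (min_le_left _ _)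
  have hεδ : r * ε ≤ η * δ / 8 := by
    have : ε ≤ η * δ / (8 * r) := (min_le_left _ _).trans (min_le_right _ _)
    rw [le_div_iff₀ (by positivity)] at this ⊢
    linarith
  have hεr : 2 * ε ≤ 1 / (r * (r - 1)) := by
    have : ε ≤ 1 / (r * (r - 1)) / 2 := min_le_right _ _
    linarith
  obtain ⟨N, κ, hκ, hN⟩ := exists_common_neighbors.{v} h hη
  obtain ⟨m₁, hm₁⟩ := exists_isBlowup_of_card_not_adj_le.{v} hr t
  set q : ℝ := 2 ^ (r * t) * h with hq
  have hq0 : 0 ≤ q := by positivity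
  refine ⟨ε, hε0, hεη, m₁ + ⌈h / κ⌉₊ + ⌈2 * (q + q / δ + r * N) / η⌉₊,
    fun V _ F hm hF hdeg => ?_⟩
  set m : ℝ := (Fintype.card V : ℝ) with hmdef
  have hmκ : (h : ℝ) ≤ κ * m := by
    rw [← div_le_iff₀' hκ]
    refine (Nat.le_ceil _).trans ?_
    rw [hmdef]
    exact_mod_cast (by omega : ⌈h / κ⌉₊ ≤ Fintype.card V)
  have hmη : 2 * (q + q / δ + r * N) ≤ η * m := by
    rw [← div_le_iff₀' hη]
    refine (Nat.le_ceil _).trans ?_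
    rw [hmdef]
    exact_mod_cast (by omega : ⌈2 * (q + q / δ + r * N) / η⌉₊ ≤ Fintype.card V)
  obtain ⟨A, hA, hAt⟩ := hm₁ V F ε hεr (by omega) hdeg
  -- vertices attached to all parts
  set Q : Finset V := {v | ∀ i, h ≤ #{a ∈ A i | F.Adj v a}} with hQ
  have hQc : (#Q : ℝ) ≤ q := by
    by_contra! hcon
    have h1 : #(univ.biUnion A) ≤ r * t := by
      refine card_biUnion_le.trans ?_
      simp [hAt]
    have h2 : 2 ^ #(univ.biUnion A) * h ≤ #Q := by
      have : 2 ^ (r * t) * h ≤ #Q := by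
        rw [hq] at hcon
        exact_mod_cast hcon.le
      refine le_trans ?_ this
      gcongr
      norm_num
    obtain ⟨A', hA', hA't⟩ := hA.exists_option (t := h) (Q := Q)
      (fun v hv i => (mem_filter.1 hv).2 i) h2 hh
    obtain ⟨i, hi⟩ := hF A' hA'
    exact absurd (hA't i) (not_le.2 hi)
  obtain ⟨g, hg⟩ : ∃ g : V → Fin r, ∀ v ∉ Q, #{a ∈ A (g v) | F.Adj v a} < h := by
    have : ∀ v, ∃ i : Fin r, v ∉ Q → #{a ∈ A i | F.Adj v a} < h := by
      intro v
      by_cases hv : v ∈ Q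
      · exact ⟨⟨0, by omega⟩, fun h => absurd hv h⟩
      · simp only [hQ, mem_filter, mem_univ, true_and, not_forall, not_le] at hv
        obtain ⟨i, hi⟩ := hv
        exact ⟨i, fun _ => hi⟩
    choose g hg using this
    exact ⟨g, hg⟩
  set X : Finset V := {v | v ∉ Q ∧ ∃ j, j ≠ g v ∧ δ * t < #{a ∈ A j | ¬ F.Adj v a}} with hX
  have hcount := card_mul_add_card_mul_le (x := δ * t) (h := h) (by omega) hmdef hdeg hAt
    (fun v hv => by exact_mod_cast (hg v hv).le)
    (fun v hv => ⟨(mem_filter.1 hv).2.1, by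
      obtain ⟨j, hj, hjc⟩ := (mem_filter.1 hv).2.2
      exact ⟨j, hj, hjc.le⟩⟩ : ∀ v ∈ X, _)
  have hXc : (#X : ℝ) ≤ η / 4 * m + q / δ := by
    have hm0 : 0 ≤ m := by positivity
    have h1 : (#X : ℝ) * (δ * t) ≤ (h + r * ε * t) * m + #Q * t := by
      have : (0 : ℝ) ≤ #Q * h := by positivity
      nlinarith [hcount]
    have h2 : (h + r * ε * t) * m ≤ (η / 4 * m) * (δ * t) := by
      have : h + r * ε * t ≤ η / 4 * (δ * t) := by nlinarith
      nlinarith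
    have h3 : (#Q : ℝ) * t ≤ q / δ * (δ * t) := by
      have : q / δ * (δ * t) = q * t := by field_simp
      rw [this]
      gcongr
    have h4 : (#X : ℝ) * (δ * t) ≤ (η / 4 * m + q / δ) * (δ * t) := by
      rw [add_mul]; linarith
    exact le_of_mul_le_mul_right h4 (by positivity)
  set U : Fin r → Finset V := fun i => {v | v ∉ Q ∧ v ∉ X ∧ g v = i} with hU
  have hUnon : ∀ i, ∀ v ∈ U i, ∀ j, j ≠ i → (#{a ∈ A j | ¬ F.Adj v a} : ℝ) ≤ δ * t := by
    intro i v hv j hj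
    obtain ⟨h1, h2, h3⟩ := (mem_filter.1 hv).2
    by_contra! hcon
    exact h2 (mem_filter.2 ⟨mem_univ _, h1, j, by rwa [h3], hcon⟩)
  -- A K_{h,h} inside a class, with its common neighbours in the other parts of `A`, would be a
  -- forbidden blow-up.
  have hUfree : ∀ i, ∀ S ⊆ U i, ∀ T ⊆ U i, #S = h → #T = h → ¬ ∀ x ∈ S, ∀ y ∈ T, F.Adj x y := by
    intro i S hS T hT hSc hTc hST
    refine hF.false_of_pair i (B := fun j => {a ∈ A j | ∀ v ∈ S ∪ T, F.Adj v a}) ?_ ?_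
      hSc.ge hTc.ge hST ?_ ?_
    · intro j k _ _ hjk a ha b hb
      exact hA j k hjk _ (mem_filter.1 ha).1 _ (mem_filter.1 hb).1
    · intro j hj
      have h1 := card_sub_le_card_common (F := F) (U := A j) (S := S ∪ T) (κ := δ * t)
        fun v hv => hUnon i v (union_subset hS hT hv) j hj
      have h2 : (#(S ∪ T) : ℝ) ≤ 2 * h := by
        have := card_union_le S T
        exact_mod_cast (by omega : #(S ∪ T) ≤ 2 * h)
      have h3 : (#(S ∪ T) : ℝ) * (δ * t) ≤ t / 2 := by
        calc (#(S ∪ T) : ℝ) * (δ * t) ≤ 2 * h * (δ * t) := by gcongr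
          _ = t / 2 := by rw [hδ]; field_simp; norm_num
      rw [hAt] at h1
      have h4 := Nat.cast_le.1 (le_trans (by linarith : (h : ℝ) ≤ _) h1)
      convert h4
    · intro s hs j _ b hb
      exact (mem_filter.1 hb).2 s (mem_union_left _ hs)
    · intro s hs j _ b hb
      exact (mem_filter.1 hb).2 s (mem_union_right _ hs)
  -- Vertices of linear degree inside their class: `N` of them would include h with h common
  -- neighbours in the class, contradicting `hUfree`.
  set K : Fin r → Finset V := fun i => {v ∈ U i | η * m < #{u ∈ U i | F.Adj v u}} with hK
  have hKc : ∀ i, #(K i) ≤ N := by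
    intro i
    by_contra! hcon
    obtain ⟨Y, hY, hYc, hYn⟩ := hN V F (U i) (K i) hcon.le fun y hy => (mem_filter.1 hy).2.le
    have h1 : h ≤ #{u ∈ U i | ∀ y ∈ Y, F.Adj y u} := by
      exact_mod_cast hmκ.trans hYn
    obtain ⟨T, hT, hTc⟩ := exists_subset_card_eq h1
    exact hUfree i Y (hY.trans (filter_subset _ _)) T (hT.trans (filter_subset _ _)) hYc hTc
      fun x hx y hy => (mem_filter.1 (hT hy)).2 x hx
  refine ⟨fun i => U i \ K i, ?_, ?_, ?_⟩
  · intro i j hij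
    rw [Finset.disjoint_left]
    intro v hvi hvj
    have h1 := (mem_filter.1 (mem_sdiff.1 hvi).1).2.2.2
    have h2 := (mem_filter.1 (mem_sdiff.1 hvj).1).2.2.2
    exact hij (h1.symm.trans h2)
  · have hcover : (univ : Finset V) ⊆
        Q ∪ X ∪ univ.biUnion K ∪ univ.biUnion fun i => U i \ K i := by
      intro v _
      simp only [mem_union, mem_biUnion, mem_univ, true_and, mem_sdiff]
      by_cases hvQ : v ∈ Q
      · exact Or.inl (Or.inl (Or.inl hvQ))
      by_cases hvX : v ∈ X
      · exact Or.inl (Or.inl (Or.inr hvX))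
      have hvU : v ∈ U (g v) := mem_filter.2 ⟨mem_univ _, hvQ, hvX, rfl⟩
      by_cases hvK : v ∈ K (g v)
      · exact Or.inl (Or.inr ⟨_, hvK⟩)
      · exact Or.inr ⟨_, hvU, hvK⟩
    have h1 := card_le_card hcover
    have h2 := card_union_le (Q ∪ X ∪ univ.biUnion K) (univ.biUnion fun i => U i \ K i)
    have h3 := card_union_le (Q ∪ X) (univ.biUnion K)
    have h4 := card_union_le Q X
    have h5 : #(univ.biUnion K) ≤ r * N := by
      refine card_biUnion_le.trans ((sum_le_sum fun i _ => hKc i).trans ?_)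
      simp
    have h6 : #(univ.biUnion fun i => U i \ K i) ≤ ∑ i, #(U i \ K i) := card_biUnion_le
    rw [card_univ] at h1
    have h7 : Fintype.card V ≤ #Q + #X + r * N + ∑ i, #(U i \ K i) := by omega
    have h8 : m ≤ #Q + #X + r * N + ∑ i, (#(U i \ K i) : ℝ) := by
      rw [hmdef]; exact_mod_cast h7
    have : 0 ≤ m := by positivity
    nlinarith
  · intro i v hv
    obtain ⟨h1, h2⟩ := mem_sdiff.1 hv
    have h3 : ¬ η * m < #{u ∈ U i | F.Adj v u} := fun h => h2 (mem_filter.2 ⟨h1, h⟩)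
    refine le_trans ?_ (not_lt.1 h3)
    exact_mod_cast card_le_card (filter_subset_filter _ sdiff_subset)

/-- A blow-up-free graph whose vertices have few non-neighbours has `r` large, almost completely
joined vertex sets, such that a vertex with few neighbours in one of them is joined to almost all
of the others. -/
theorem BlowupFree.exists_near_complete_parts {r h : ℕ} (hr : 2 ≤ r) (hh : 1 ≤ h) {δ : ℝ}
    (hδ : 0 < δ) :
    ∃ ε : ℝ, 0 < ε ∧ ∃ m₀ : ℕ, ∀ (V : Type v) [Fintype V] (F : SimpleGraph V),
      m₀ ≤ Fintype.card V → F.BlowupFree r h →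
      (∀ v, (#{u | ¬ F.Adj v u} : ℝ) ≤ (1 / r + ε) * Fintype.card V) →
      ∃ P : Fin r → Finset V,
        (∀ i, (1 / r - δ) * Fintype.card V ≤ #(P i)) ∧
        (∀ i j, i ≠ j → ∀ v ∈ P i, (#{u ∈ P j | ¬ F.Adj v u} : ℝ) ≤ δ * Fintype.card V) ∧
        ∀ (c : ℝ) (v : V) (i j : Fin r), i ≠ j →
          (#{u ∈ P i | F.Adj v u} : ℝ) ≤ c * Fintype.card V →
          (#{u ∈ P j | ¬ F.Adj v u} : ℝ) ≤ (c + δ) * Fintype.card V := by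
  have hr' : (2 : ℝ) ≤ r := by exact_mod_cast hr
  have hr0 : (0 : ℝ) < r := by linarith
  set η : ℝ := δ / (4 * r) with hη
  have hη0 : 0 < η := by positivity
  have hηδ : 4 * (r * η) = δ := by rw [hη]; field_simp
  obtain ⟨ε, hε, hεη, m₀, hm₀⟩ := BlowupFree.exists_sparse_parts.{v} hr hh hη0
  refine ⟨ε, hε, m₀, fun V _ F hm hF hdeg => ?_⟩
  obtain ⟨P, hdisj, hcov, hsparse⟩ := hm₀ V F hm hF hdeg
  set m : ℝ := (Fintype.card V : ℝ) with hmdef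
  have hm0 : 0 ≤ m := by rw [hmdef]; exact Nat.cast_nonneg _
  have hsplit : ∀ v i, (#(P i) : ℝ) = #{u ∈ P i | F.Adj v u} + #{u ∈ P i | ¬ F.Adj v u} := by
    intro v i
    exact_mod_cast (card_filter_add_card_filter_not (s := P i) (F.Adj v)).symm
  have hup : ∀ i, (#(P i) : ℝ) ≤ (1 / r + 2 * η) * m := by
    intro i
    rcases (P i).eq_empty_or_nonempty with h | ⟨v, hv⟩
    · rw [h, card_empty, Nat.cast_zero]
      exact mul_nonneg (by positivity) hm0
    · have h1 := hsparse i v hv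
      have h2 : (#{u ∈ P i | ¬ F.Adj v u} : ℝ) ≤ #{u | ¬ F.Adj v u} := by
        exact_mod_cast card_le_card (filter_subset_filter _ (subset_univ _))
      have h3 := hdeg v
      rw [hsplit v i]
      nlinarith
  -- The parts cover (1 - η)m vertices and the other r - 1 are bounded by `hup`.
  have hlow : ∀ i, (1 / r - 2 * (r * η)) * m ≤ #(P i) := by
    intro i
    have h1 := add_sum_erase univ (fun j => (#(P j) : ℝ)) (mem_univ i)
    have h2 : ∑ j ∈ univ.erase i, (#(P j) : ℝ) ≤ (r - 1) * ((1 / r + 2 * η) * m) := by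
      refine (sum_le_sum fun j _ => hup j).trans (le_of_eq ?_)
      rw [sum_const, card_erase_of_mem (mem_univ i), card_univ, Fintype.card_fin, nsmul_eq_mul,
        Nat.cast_sub (by omega), Nat.cast_one]
    have h3 : (r - 1) * ((1 / r + 2 * η) * m) = (1 - 1 / r) * m + 2 * (r * η) * m - 2 * η * m := by
      field_simp
      ring
    have : 0 ≤ η * m := by positivity
    nlinarith
  -- A vertex with few neighbours in `P i` spends almost all of its (1/r + ε)m non-neighbours there,
  -- leaving few for `P j`.
  have hthird : ∀ (c : ℝ) (v : V) (i j : Fin r), i ≠ j →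
      (#{u ∈ P i | F.Adj v u} : ℝ) ≤ c * m →
      (#{u ∈ P j | ¬ F.Adj v u} : ℝ) ≤ (c + (2 * (r * η) + η)) * m := by
    intro c v i j hij hc
    have h1 : #{u ∈ P i | ¬ F.Adj v u} + #{u ∈ P j | ¬ F.Adj v u} ≤ #{u | ¬ F.Adj v u} := by
      rw [← card_union_of_disjoint
        (disjoint_filter_filter (hdisj i j hij)), ← filter_union]
      exact card_le_card (filter_subset_filter _ (subset_univ _))
    have h2 : (#{u ∈ P i | ¬ F.Adj v u} : ℝ) + #{u ∈ P j | ¬ F.Adj v u} ≤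
        #{u | ¬ F.Adj v u} := by exact_mod_cast h1
    have h3 := hsplit v i
    have h4 := hlow i
    have h5 := hdeg v
    have h6 : ε * m ≤ η * m := by gcongr
    nlinarith
  have hrη : η ≤ r * η := by nlinarith
  refine ⟨P, fun i => ?_, fun i j hij v hv => ?_, fun c v i j hij hc => ?_⟩
  · refine le_trans ?_ (hlow i)
    gcongr
    nlinarith
  · refine (hthird η v i j hij (hsparse i v hv)).trans ?_
    gcongr
    linarith
  · refine (hthird c v i j hij hc).trans ?_
    gcongr
    linarith

/-! ### Few monochromatic edges in the general case. -/

/-- The **Kővári–Sós–Turán theorem**. -/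
theorem sum_card_adj_le_of_no_complete_pair {h : ℕ} (hh : 1 ≤ h) :
    ∃ C : ℝ, 0 ≤ C ∧ ∀ (V : Type v) [Fintype V] (F : SimpleGraph V),
      (∀ S T : Finset V, #S = h → #T = h → ¬ ∀ x ∈ S, ∀ y ∈ T, F.Adj x y) →
      ∑ v, (#{u | F.Adj v u} : ℝ) ≤ C * (Fintype.card V : ℝ) ^ (2 - 1 / (h : ℝ)) := by
  set K : ℕ := h.factorial * h with hK
  have hK1 : 1 ≤ K := Nat.mul_pos h.factorial_pos hh
  have hh' : (1 : ℝ) ≤ h := by exact_mod_cast hh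
  refine ⟨K + h, by positivity, fun V _ F hF => ?_⟩
  set m : ℕ := Fintype.card V with hm
  set d : V → ℕ := fun v => #{u | F.Adj v u} with hd
  -- Double count of pairs (v, S) with S an h-set of neighbours of v.
  have h1 : ∑ v, (d v).choose h ≤ m ^ h * h := by
    calc ∑ v, (d v).choose h
        = ∑ v, #{S ∈ powersetCard h (univ : Finset V) | ∀ x ∈ S, F.Adj x v} := by
          refine sum_congr rfl fun v _ => ?_
          rw [← card_powersetCard]
          congr 1
          ext S
          simp only [mem_powersetCard, mem_filter, subset_iff, mem_univ, true_and, implies_true,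
            F.adj_comm v]
          tauto
      _ = ∑ S ∈ powersetCard h (univ : Finset V), #{v | ∀ x ∈ S, F.Adj x v} :=
          sum_card_bipartiteAbove_eq_sum_card_bipartiteBelow fun v S => ∀ x ∈ S, F.Adj x v
      _ ≤ ∑ S ∈ powersetCard h (univ : Finset V), h := by
          refine sum_le_sum fun S hS => ?_
          by_contra! hcon
          obtain ⟨T, hT, hTc⟩ := exists_subset_card_eq hcon.le
          exact hF S T (mem_powersetCard.1 hS).2 hTc fun x hx y hy => (mem_filter.1 (hT hy)).2 x hx
      _ ≤ m ^ h * h := by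
          rw [sum_const, card_powersetCard, card_univ, smul_eq_mul]
          gcongr
          exact Nat.choose_le_pow _ _
  -- Truncated subtraction makes this hold also for degrees below h; the truncation costs at most h
  -- per vertex in `h6`.
  have h2 : ∀ v, (d v + 1 - h) ^ h ≤ h.factorial * (d v).choose h := fun v => by
    rw [← Nat.descFactorial_eq_factorial_mul_choose]
    exact Nat.pow_sub_le_descFactorial _ _
  have h3 : (∑ v, (d v + 1 - h)) ^ h ≤ K * m ^ (2 * h - 1) := by
    obtain ⟨n, rfl⟩ : ∃ n, h = n + 1 := ⟨h - 1, by omega⟩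
    calc (∑ v, (d v + 1 - (n + 1))) ^ (n + 1)
        ≤ #(univ : Finset V) ^ n * ∑ v, (d v + 1 - (n + 1)) ^ (n + 1) :=
          pow_sum_le_card_mul_sum_pow (fun _ _ => Nat.zero_le _) n
      _ ≤ m ^ n * ((n + 1).factorial * (m ^ (n + 1) * (n + 1))) := by
          rw [card_univ]
          gcongr
          refine (sum_le_sum fun v _ => h2 v).trans ?_
          rw [← mul_sum]
          gcongr
      _ = K * m ^ (2 * (n + 1) - 1) := by
          rw [show 2 * (n + 1) - 1 = n + (n + 1) by omega, pow_add, hK]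
          ring
  have hexp : ((m : ℝ) ^ (2 - 1 / (h : ℝ))) ^ h = (m : ℝ) ^ (2 * h - 1) := by
    rw [← Real.rpow_natCast, ← Real.rpow_mul (Nat.cast_nonneg _), ← Real.rpow_natCast]
    congr 1
    rw [Nat.cast_sub (by omega)]
    push_cast
    field_simp
  have hpow0 : (0 : ℝ) ≤ (m : ℝ) ^ (2 - 1 / (h : ℝ)) := by positivity
  have h4 : ((∑ v, (d v + 1 - h) : ℕ) : ℝ) ≤ K * (m : ℝ) ^ (2 - 1 / (h : ℝ)) := by
    rw [← pow_le_pow_iff_left₀ (Nat.cast_nonneg _) (by positivity) (by omega : h ≠ 0), mul_pow,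
      hexp]
    have h5 : (K : ℝ) ≤ (K : ℝ) ^ h := le_self_pow₀ (by exact_mod_cast hK1) (by omega)
    calc ((∑ v, (d v + 1 - h) : ℕ) : ℝ) ^ h ≤ K * (m : ℝ) ^ (2 * h - 1) := by exact_mod_cast h3
      _ ≤ _ := by gcongr
  have h5 : (m : ℝ) ≤ (m : ℝ) ^ (2 - 1 / (h : ℝ)) := by
    rcases Nat.eq_zero_or_pos m with h0 | h0
    · rw [h0, Nat.cast_zero]
      exact Real.rpow_nonneg le_rfl _
    · conv_lhs => rw [← Real.rpow_one (m : ℝ)]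
      refine Real.rpow_le_rpow_of_exponent_le (by exact_mod_cast h0) ?_
      have : 1 / (h : ℝ) ≤ 1 := by rw [div_le_one (by linarith)]; exact hh'
      linarith
  have h6 : ∑ v, d v ≤ ∑ v, (d v + 1 - h) + m * h := by
    have : ∑ v : V, h = m * h := by simp [hm]
    rw [← this, ← sum_add_distrib]
    exact sum_le_sum fun v _ => by omega
  have h7 : ∑ v, (d v : ℝ) ≤ ((∑ v, (d v + 1 - h) : ℕ) : ℝ) + m * h := by exact_mod_cast h6
  calc ∑ v, (d v : ℝ) ≤ K * (m : ℝ) ^ (2 - 1 / (h : ℝ)) + (m : ℝ) ^ (2 - 1 / (h : ℝ)) * h := by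
        refine h7.trans ?_
        gcongr
    _ = _ := by ring

/-- A blow-up-free graph whose vertices have few non-neighbours has a vertex partition into `r`
parts with few edges inside the parts. -/
theorem BlowupFree.exists_few_monochromatic {r h : ℕ} (hr : 2 ≤ r) (hh : 1 ≤ h) :
    ∃ ε : ℝ, 0 < ε ∧ ∃ m₀ : ℕ, ∃ C : ℝ, 0 ≤ C ∧
      ∀ (V : Type v) [Fintype V] (F : SimpleGraph V),
      m₀ ≤ Fintype.card V → F.BlowupFree r h →
      (∀ v, (#{u | ¬ F.Adj v u} : ℝ) ≤ (1 / r + ε) * Fintype.card V) →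
      ∃ f : V → Fin r, ∑ v, (#{u | F.Adj v u ∧ f v = f u} : ℝ) ≤
        C * (Fintype.card V : ℝ) ^ (2 - 1 / (h : ℝ)) := by
  have hr' : (2 : ℝ) ≤ r := by exact_mod_cast hr
  have hr0 : (0 : ℝ) < r := by linarith
  have hh' : (1 : ℝ) ≤ h := by exact_mod_cast hh
  have hh0 : (0 : ℝ) < h := by linarith
  -- Chosen with `δ` so that 2h vertices, each missing at most (c + δ)m of a part, keep m/(2r) ≥ βm
  -- common neighbours in it.
  set c : ℝ := 1 / (16 * (h * r)) with hc
  have hc0 : 0 < c := by positivity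
  obtain ⟨N, κ, hκ, hN⟩ := exists_common_neighbors_family.{v} (univ : Finset (Fin r)) hc0 h
  set β : ℝ := min (1 / (2 * r)) κ with hβ
  have hβ0 : 0 < β := lt_min (by positivity) hκ
  set δ : ℝ := min (1 / (24 * (h * r))) (β / (2 * (r * h))) with hδ
  have hδ0 : 0 < δ := lt_min (by positivity) (by positivity)
  obtain ⟨ε, hε, m₀, hm₀⟩ := BlowupFree.exists_near_complete_parts.{v} hr hh hδ0
  obtain ⟨C, hC, hKST⟩ := sum_card_adj_le_of_no_complete_pair.{v} hh
  refine ⟨ε, hε, m₀ + ⌈2 * (r * h) / β⌉₊ + 1, C + 2 * N, by positivity,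
    fun V _ F hm hF hdeg => ?_⟩
  obtain ⟨P, hP1, hP2, hP3⟩ := hm₀ V F (by omega) hF hdeg
  set m : ℝ := (Fintype.card V : ℝ) with hmdef
  have hm0 : 0 ≤ m := by rw [hmdef]; exact Nat.cast_nonneg _
  have hm1 : 1 ≤ m := by rw [hmdef]; exact_mod_cast (by omega : 1 ≤ Fintype.card V)
  have hne : Nonempty V := Fintype.card_pos_iff.1 (by omega)
  have hmβ : 2 * (r * h) ≤ β * m := by
    rw [← div_le_iff₀' hβ0]
    refine (Nat.le_ceil _).trans ?_
    rw [hmdef]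
    exact_mod_cast (by omega : ⌈2 * (r * h) / β⌉₊ ≤ Fintype.card V)
  have hδβ : r * h * (δ * m + 1) ≤ β * m := by
    have h1 : δ ≤ β / (2 * (r * h)) := min_le_right _ _
    rw [le_div_iff₀ (by positivity)] at h1
    nlinarith
  -- complete multipartite subgraphs can be found inside large subsets of the parts
  have hgreedy : ∀ B : Fin r → Finset V, (∀ i, B i ⊆ P i) → (∀ i, β * m ≤ #(B i)) →
      ∃ A : Fin r → Finset V, F.IsBlowup A ∧ ∀ i, A i ⊆ B i ∧ #(A i) = h := by
    intro B hB hBc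
    refine exists_isBlowup_of_almost_joined (κ := δ * m) (by positivity) ?_ h fun i => ?_
    · intro i j hij a ha
      refine le_trans ?_ (hP2 i j hij a (hB i ha))
      exact_mod_cast card_le_card (filter_subset_filter _ (hB j))
    · rw [Fintype.card_fin]
      exact hδβ.trans (hBc i)
  -- If `Y` were large, h of its vertices would have linear common neighbourhoods in all parts, and
  -- a greedy blow-up there would gain them as an extra part.
  set Y : Finset V := {v | ∀ i, c * m ≤ #{u ∈ P i | F.Adj v u}} with hY
  have hYc : #Y ≤ N := by
    by_contra! hcon
    obtain ⟨Y', hY', hY'c, hY'n⟩ := hN V F P Y hcon.le fun y hy i _ => (mem_filter.1 hy).2 i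
    obtain ⟨A, hA, hAB⟩ := hgreedy (fun i => {u ∈ P i | ∀ y ∈ Y', F.Adj y u})
      (fun i => filter_subset _ _) fun i => by
        refine le_trans ?_ (hY'n i (mem_univ _))
        gcongr
        exact min_le_right _ _
    have hadj : ∀ y ∈ Y', ∀ i, ∀ a ∈ A i, F.Adj y a := fun y hy i a ha =>
      (mem_filter.1 ((hAB i).1 ha)).2 y hy
    have i₀ : Fin r := ⟨0, by omega⟩
    obtain ⟨o, ho⟩ := hF (fun o => o.elim Y' A) (by
      rintro (_ | i) (_ | j) hij a ha b hb
      · exact absurd rfl hij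
      · exact hadj _ ha _ _ hb
      · exact (hadj _ hb _ _ ha).symm
      · exact hA i j (fun h => hij (by rw [h])) _ ha _ hb)
    rcases o with _ | i
    · exact absurd hY'c ho.ne
    · exact absurd (hAB i).2 ho.ne
  obtain ⟨f, hf⟩ : ∃ f : V → Fin r, ∀ v ∉ Y, (#{u ∈ P (f v) | F.Adj v u} : ℝ) ≤ c * m := by
    have : ∀ v, ∃ i : Fin r, v ∉ Y → (#{u ∈ P i | F.Adj v u} : ℝ) ≤ c * m := by
      intro v
      by_cases hv : v ∈ Y
      · exact ⟨⟨0, by omega⟩, fun h => absurd hv h⟩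
      · simp only [hY, mem_filter, mem_univ, true_and, not_forall, not_le] at hv
        obtain ⟨i, hi⟩ := hv
        exact ⟨i, fun _ => hi.le⟩
    choose f hf using this
    exact ⟨f, hf⟩
  refine ⟨f, ?_⟩
  let F' : SimpleGraph V :=
    { Adj := fun x y => F.Adj x y ∧ f x = f y ∧ x ∉ Y ∧ y ∉ Y
      symm := ⟨fun x y h => ⟨h.1.symm, h.2.1.symm, h.2.2.2, h.2.2.1⟩⟩
      loopless := ⟨fun x h => F.irrefl h.1⟩ }
  have hF' : ∀ S T : Finset V, #S = h → #T = h → ¬ ∀ x ∈ S, ∀ y ∈ T, F'.Adj x y := by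
    intro S T hS hT hST
    obtain ⟨x₀, hx₀⟩ := card_pos.1 (by omega : 0 < #S)
    obtain ⟨y₀, hy₀⟩ := card_pos.1 (by omega : 0 < #T)
    set i := f x₀ with hi
    have hall : ∀ v ∈ S ∪ T, v ∉ Y ∧ f v = i := by
      intro v hv
      rcases mem_union.1 hv with hv | hv
      · exact ⟨(hST v hv y₀ hy₀).2.2.1, (hST v hv y₀ hy₀).2.1.trans (hST x₀ hx₀ y₀ hy₀).2.1.symm⟩
      · exact ⟨(hST x₀ hx₀ v hv).2.2.2, (hST x₀ hx₀ v hv).2.1.symm⟩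
    -- Part i is left unrestricted: `false_of_pair` does not use it, but `hgreedy` needs a large set
    -- at every index.
    obtain ⟨A, hA, hAB⟩ := hgreedy (fun j => {u ∈ P j | ∀ v ∈ S ∪ T, j ≠ i → F.Adj v u})
      (fun i => filter_subset _ _) fun j => by
        have h0 : β ≤ 1 / (2 * r) := min_le_left _ _
        have h1 : δ * (24 * (h * r)) ≤ 1 := by
          have : δ ≤ 1 / (24 * (h * r)) := min_le_left _ _
          rwa [le_div_iff₀ (by positivity)] at this
        have hrinv : 1 / (2 * r : ℝ) = 1 / r / 2 := by field_simp
        have hhδ : h * δ ≤ 1 / r / 24 := by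
          rw [div_div, le_div_iff₀ (by positivity)]; linarith
        have hδh : δ ≤ h * δ := by nlinarith
        have hhc : h * c = 1 / r / 16 := by rw [hc]; field_simp
        have hri : (0 : ℝ) < 1 / r := by positivity
        by_cases hj : j = i
        · have h2 : ({u ∈ P j | ∀ v ∈ S ∪ T, j ≠ i → F.Adj v u} : Finset V) = P j :=
            filter_true_of_mem fun u _ v _ hne => absurd hj hne
          rw [h2]
          refine le_trans ?_ (hP1 j)
          gcongr
          linarith
        · have h2 := card_sub_le_card_common (F := F) (U := P j) (S := S ∪ T) (κ := (c + δ) * m)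
            fun v hv => hP3 c v i j (Ne.symm hj) (by
              have := hf v (hall v hv).1
              rwa [(hall v hv).2] at this)
          have h3 : (#(S ∪ T) : ℝ) ≤ 2 * h := by
            have := card_union_le S T
            exact_mod_cast (by omega : #(S ∪ T) ≤ 2 * h)
          have h4 : (#(S ∪ T) : ℝ) * ((c + δ) * m) ≤ 2 * h * ((c + δ) * m) := by gcongr
          have h5 : (#(P j) : ℝ) - #(S ∪ T) * ((c + δ) * m) ≤
              #{u ∈ P j | ∀ v ∈ S ∪ T, j ≠ i → F.Adj v u} := by
            refine h2.trans (le_of_eq ?_)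
            congr 2
            ext u
            simp only [mem_filter, ne_eq, hj, not_false_iff, true_imp_iff]
          refine le_trans ?_ ((sub_le_sub_left h4 _).trans h5)
          have h7 := hP1 j
          have h8 : β ≤ 1 / r - δ - 2 * h * (c + δ) := by
            have : 2 * h * (c + δ) = 2 * (h * c) + 2 * (h * δ) := by ring
            rw [this, hhc]
            linarith
          have h9 := mul_le_mul_of_nonneg_right h8 hm0
          linarith
    refine hF.false_of_pair i (B := A) (fun j k _ _ hjk => hA j k hjk) (fun j _ => (hAB j).2.ge)
      hS.ge hT.ge (fun s hs t ht => (hST s hs t ht).1) ?_ ?_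
    · intro s hs j hj b hb
      exact (mem_filter.1 ((hAB j).1 hb)).2 s (mem_union_left _ hs) hj
    · intro s hs j hj b hb
      exact (mem_filter.1 ((hAB j).1 hb)).2 s (mem_union_right _ hs) hj
  have h1 : ∑ v, (#{u | F'.Adj v u} : ℝ) ≤ C * m ^ (2 - 1 / (h : ℝ)) := by
    convert hKST V F' hF'
  -- Ordered pairs meeting `Y` number at most 2Nm, absorbed because 2 - 1/h ≥ 1.
  have h2 : ∀ v : V, (#{u | F.Adj v u ∧ f v = f u} : ℝ) ≤
      #{u | F'.Adj v u} + ((if v ∈ Y then m else 0) + #Y) := by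
    intro v
    by_cases hv : v ∈ Y
    · rw [if_pos hv]
      have h3 : (#{u | F.Adj v u ∧ f v = f u} : ℝ) ≤ m := by
        rw [hmdef]
        exact_mod_cast card_le_univ _
      have h4 : (0 : ℝ) ≤ #{u | F'.Adj v u} := Nat.cast_nonneg _
      have h5 : (0 : ℝ) ≤ #Y := Nat.cast_nonneg _
      linarith
    · rw [if_neg hv, zero_add]
      have h3 : ({u | F.Adj v u ∧ f v = f u} : Finset V) ⊆ ({u | F'.Adj v u} : Finset V) ∪ Y := by
        intro u hu
        have hu' := (mem_filter.1 hu).2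
        by_cases huY : u ∈ Y
        · exact mem_union_right _ huY
        · exact mem_union_left _ (mem_filter.2 ⟨mem_univ _, hu'.1, hu'.2, hv, huY⟩)
      exact_mod_cast (card_le_card h3).trans (card_union_le _ _)
  have hYN : (#Y : ℝ) ≤ N := by exact_mod_cast hYc
  have hmpow : m ≤ m ^ (2 - 1 / (h : ℝ)) := by
    conv_lhs => rw [← Real.rpow_one m]
    refine Real.rpow_le_rpow_of_exponent_le hm1 ?_
    have : 1 / (h : ℝ) ≤ 1 := by rw [div_le_one (by linarith)]; exact hh'
    linarith
  refine (sum_le_sum fun v _ => h2 v).trans ?_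
  rw [sum_add_distrib, sum_add_distrib, ← sum_filter, sum_const, sum_const, card_univ,
    nsmul_eq_mul, nsmul_eq_mul]
  have h3 : ({v | v ∈ Y} : Finset V) = Y := by ext; simp
  rw [h3, ← hmdef]
  have h4 : (#Y : ℝ) * m ≤ N * m ^ (2 - 1 / (h : ℝ)) := by gcongr
  linarith [mul_comm m (#Y : ℝ)]

/-! ### Exact colourability when there is a critical edge. -/

/-- If `H` has a critical edge, then an `H`-free graph whose vertices have few non-neighbours is
`r`-colorable. -/
theorem colorable_of_free_of_critical {W : Type u} [Fintype W] {H : SimpleGraph W} {r : ℕ}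
    (hr : 2 ≤ r) (hH : H.Colorable (r + 1)) (hH' : ¬ H.Colorable r) {a b : W} (hab : H.Adj a b)
    (hcrit : (H.deleteEdges {s(a, b)}).Colorable r) :
    ∃ ε : ℝ, 0 < ε ∧ ∃ m₀ : ℕ, ∀ (V : Type v) [Fintype V] (F : SimpleGraph V),
      m₀ ≤ Fintype.card V → H.Free F →
      (∀ v, (#{u | ¬ F.Adj v u} : ℝ) ≤ (1 / r + ε) * Fintype.card V) → F.Colorable r := by
  have hr' : (2 : ℝ) ≤ r := by exact_mod_cast hr
  have hr0 : (0 : ℝ) < r := by linarith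
  set h : ℕ := Fintype.card W with hhdef
  have hh : 1 ≤ h := Fintype.card_pos_iff.2 ⟨a⟩
  have hh' : (1 : ℝ) ≤ h := by exact_mod_cast hh
  have hh0 : (0 : ℝ) < h := by linarith
  obtain ⟨col⟩ := hcrit
  have hadj : ∀ x y, H.Adj x y → s(x, y) ≠ s(a, b) → col x ≠ col y := by
    intro x y hxy hne
    exact col.valid (by simpa [deleteEdges_adj, hxy] using hne)
  -- Otherwise `col` would properly colour `H` itself.
  have hcab : col a = col b := by
    by_contra hne
    refine hH' ⟨Coloring.mk col ?_⟩
    intro x y hxy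
    by_cases he : s(x, y) = s(a, b)
    · rcases Sym2.eq_iff.1 he with ⟨rfl, rfl⟩ | ⟨rfl, rfl⟩
      · exact hne
      · exact Ne.symm hne
    · exact hadj x y hxy he
  set c : ℝ := 1 / (16 * (h * r)) with hc
  have hc0 : 0 < c := by positivity
  set δ : ℝ := min (1 / (24 * (h * r))) (c / (2 * h)) with hδ
  have hδ0 : 0 < δ := lt_min (by positivity) (by positivity)
  obtain ⟨ε, hε, m₀, hm₀⟩ := BlowupFree.exists_near_complete_parts.{v} hr hh hδ0
  refine ⟨ε, hε, m₀ + ⌈2 * h / c⌉₊ + 1, fun V _ F hm hF hdeg => ?_⟩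
  obtain ⟨P, hP1, hP2, hP3⟩ := hm₀ V F (by omega) (hF.blowupFree hH) hdeg
  set m : ℝ := (Fintype.card V : ℝ) with hmdef
  have hm0 : 0 ≤ m := by rw [hmdef]; exact Nat.cast_nonneg _
  have hne : Nonempty V := Fintype.card_pos_iff.1 (by omega)
  have hmc : 2 * (h : ℝ) ≤ c * m := by
    rw [← div_le_iff₀' hc0]
    refine (Nat.le_ceil _).trans ?_
    rw [hmdef]
    exact_mod_cast (by omega : ⌈2 * h / c⌉₊ ≤ Fintype.card V)
  have hδc : h * (δ * m + 1) ≤ c * m := by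
    have h1 : δ ≤ c / (2 * h) := min_le_right _ _
    rw [le_div_iff₀ (by positivity)] at h1
    nlinarith
  have hgreedy : ∀ (σ : Equiv.Perm (Fin r)) (B : Fin r → Finset V) (s : Finset W),
      (∀ i, B i ⊆ P (σ i)) →
      (∀ i, c * m ≤ #(B i)) → ∃ φ : W → V, (∀ x ∈ s, φ x ∈ B (col x)) ∧ Set.InjOn φ s ∧
        ∀ x ∈ s, ∀ y ∈ s, col x ≠ col y → F.Adj (φ x) (φ y) := by
    intro σ B s hB hBc
    refine exists_greedy_embedding (κ := δ * m) (by positivity) ?_ col s fun i => ?_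
    · intro i j hij a ha
      refine le_trans ?_ (hP2 _ _ (σ.injective.ne hij) a (hB i ha))
      exact_mod_cast card_le_card (filter_subset_filter _ (hB j))
    · refine le_trans ?_ (hδc.trans (hBc i))
      gcongr
      exact card_le_univ s
  -- If `v` had linear degree to every part, H - a would embed in the neighbourhood of `v`, with `v`
  -- playing `a`. Hence there is no exceptional set.
  have hf : ∀ v, ∃ i, (#{u ∈ P i | F.Adj v u} : ℝ) ≤ c * m := by
    intro v
    by_contra! hcon
    obtain ⟨φ, h1, h2, h3⟩ := hgreedy 1 (fun i => {u ∈ P i | F.Adj v u}) (univ.erase a)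
      (fun i => filter_subset _ _) fun i => (hcon i).le
    have h1' : ∀ x, x ≠ a → F.Adj v (φ x) := fun x hx =>
      (mem_filter.1 (h1 x (mem_erase.2 ⟨hx, mem_univ _⟩))).2
    refine hF ⟨⟨⟨Function.update φ a v, ?_⟩, ?_⟩⟩
    · intro x y hxy
      by_cases hx : x = a
      · subst hx
        rw [Function.update_self, Function.update_of_ne hxy.ne']
        exact h1' y hxy.ne'
      by_cases hy : y = a
      · subst hy
        rw [Function.update_self, Function.update_of_ne hx]
        exact (h1' x hx).symm
      rw [Function.update_of_ne hx, Function.update_of_ne hy]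
      refine h3 x (by simp [hx]) y (by simp [hy]) (hadj x y hxy fun he => ?_)
      rcases Sym2.eq_iff.1 he with ⟨h, -⟩ | ⟨-, h⟩
      · exact hx h
      · exact hy h
    · intro x y hxy
      change Function.update φ a v x = Function.update φ a v y at hxy
      by_cases hx : x = a <;> by_cases hy : y = a
      · rw [hx, hy]
      · subst hx
        rw [Function.update_self, Function.update_of_ne hy] at hxy
        exact absurd hxy (h1' y hy).ne
      · subst hy
        rw [Function.update_self, Function.update_of_ne hx] at hxy
        exact absurd hxy.symm (h1' x hx).ne
      · rw [Function.update_of_ne hx, Function.update_of_ne hy] at hxy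
        exact h2 (by simp [hx]) (by simp [hy]) hxy
  choose f hf using hf
  refine ⟨Coloring.mk f ?_⟩
  intro x y hxy hfxy
  set i := f x with hi
  set σ : Equiv.Perm (Fin r) := Equiv.swap (col a) i with hσ
  have hσa : σ (col a) = i := Equiv.swap_apply_left _ _
  have hδ1 : δ * (24 * (h * r)) ≤ 1 := by
    have : δ ≤ 1 / (24 * (h * r)) := min_le_left _ _
    rwa [le_div_iff₀ (by positivity)] at this
  have hri : (0 : ℝ) < 1 / r := by positivity
  have hδr : δ ≤ 1 / r / 24 := by
    rw [div_div, le_div_iff₀ (by positivity)]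
    have : δ * (r * 24) ≤ δ * (r * 24) * h := le_mul_of_one_le_right (by positivity) hh'
    linarith
  have hcr : c ≤ 1 / r / 16 := by
    rw [hc, div_div]
    refine one_div_le_one_div_of_le (by positivity) ?_
    have : r * 16 ≤ r * 16 * (h : ℝ) := le_mul_of_one_le_right (by positivity) hh'
    linarith
  -- The edge xy plays ab, and `σ` sends their common colour to the class of `x` and `y`. Other
  -- vertices of that colour are not adjacent to `a` or `b`, so they need only avoid `x` and `y`;
  -- the remaining colours use common neighbours of `x` and `y`.
  obtain ⟨φ, h1, h2, h3⟩ := hgreedy σ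
    (fun j => {w ∈ P (σ j) | (w ≠ x ∧ w ≠ y) ∧ (j ≠ col a → F.Adj x w ∧ F.Adj y w)})
    ((univ.erase a).erase b) (fun j => filter_subset _ _) fun j => by
      by_cases hj : j = col a
      · have h1 : P (σ j) \ {x, y} ⊆
            {w ∈ P (σ j) | (w ≠ x ∧ w ≠ y) ∧ (j ≠ col a → F.Adj x w ∧ F.Adj y w)} := by
          intro w hw
          simp only [mem_sdiff, mem_insert, mem_singleton, not_or] at hw
          exact mem_filter.2 ⟨hw.1, hw.2, fun hne => absurd hj hne⟩
        have h2 : #(P (σ j)) ≤ #(P (σ j) \ {x, y}) + 2 := by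
          have := le_card_sdiff {x, y} (P (σ j))
          have h3 := card_le_two (a := x) (b := y)
          omega
        have h3 : (#(P (σ j)) : ℝ) ≤ #{w ∈ P (σ j) | (w ≠ x ∧ w ≠ y) ∧
            (j ≠ col a → F.Adj x w ∧ F.Adj y w)} + 2 := by
          exact_mod_cast h2.trans (Nat.add_le_add_right (card_le_card h1) 2)
        have h4 := hP1 (σ j)
        have h5 : 2 * c ≤ 1 / r - δ := by linarith
        have h6 := mul_le_mul_of_nonneg_right h5 hm0
        linarith
      · have hσj : i ≠ σ j := by
          rw [← hσa]
          exact σ.injective.ne (Ne.symm hj)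
        have h1 := card_sub_le_card_common (F := F) (U := P (σ j)) (S := {x, y})
          (κ := (c + δ) * m) (by
            intro v hv
            simp only [mem_insert, mem_singleton] at hv
            rcases hv with rfl | rfl
            · exact hP3 c _ i _ hσj (hf _)
            · exact hP3 c _ i _ hσj (by rw [hfxy]; exact hf _))
        have h2 : (#({x, y} : Finset V) : ℝ) ≤ 2 := by exact_mod_cast card_le_two
        have h3 : (#({x, y} : Finset V) : ℝ) * ((c + δ) * m) ≤ 2 * ((c + δ) * m) := by gcongr
        have hmono : ∀ D E : Finset V, D ⊆ E → (#D : ℝ) ≤ #E := fun D E hDE =>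
          Nat.cast_le.2 (card_le_card hDE)
        refine le_trans ?_ ((sub_le_sub_left h3 _).trans (h1.trans (hmono _ _ ?_)))
        · have h4 := hP1 (σ j)
          have h5 : c ≤ 1 / r - δ - 2 * (c + δ) := by linarith
          have h6 := mul_le_mul_of_nonneg_right h5 hm0
          linarith
        · intro w hw
          simp only [mem_filter] at hw
          obtain ⟨hwP, hw⟩ := hw
          have hxw := hw x (by simp)
          have hyw := hw y (by simp)
          exact mem_filter.2 ⟨hwP, ⟨hxw.ne', hyw.ne'⟩, fun _ => ⟨hxw, hyw⟩⟩
  have h1' : ∀ z, z ≠ a → z ≠ b → (φ z ≠ x ∧ φ z ≠ y) ∧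
      (col z ≠ col a → F.Adj x (φ z) ∧ F.Adj y (φ z)) := fun z hza hzb =>
    (mem_filter.1 (h1 z (by simp [hza, hzb]))).2
  have hba : b ≠ a := hab.ne'
  set ψ : W → V := Function.update (Function.update φ b y) a x with hψ
  have hψa : ψ a = x := Function.update_self _ _ _
  have hψb : ψ b = y := by rw [hψ, Function.update_of_ne hba, Function.update_self]
  have hψz : ∀ z, z ≠ a → z ≠ b → ψ z = φ z := fun z hza hzb => by
    rw [hψ, Function.update_of_ne hza, Function.update_of_ne hzb]
  have hψadj : ∀ w z, H.Adj w z → z ≠ a → z ≠ b → F.Adj (ψ w) (ψ z) := by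
    intro w z hwz hza hzb
    have hcol : col w ≠ col z := hadj w z hwz fun he => by
      rcases Sym2.eq_iff.1 he with ⟨-, h⟩ | ⟨-, h⟩
      · exact hzb h
      · exact hza h
    rw [hψz z hza hzb]
    by_cases hwa : w = a
    · rw [hwa, hψa]
      exact ((h1' z hza hzb).2 fun he => hcol ((congrArg col hwa).trans he.symm)).1
    by_cases hwb : w = b
    · rw [hwb, hψb]
      exact ((h1' z hza hzb).2 fun he =>
        hcol ((congrArg col hwb).trans (hcab.symm.trans he.symm))).2
    rw [hψz w hwa hwb]
    exact h3 w (by simp [hwa, hwb]) z (by simp [hza, hzb]) hcol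
  have hψinj : ∀ w z, w ≠ z → z ≠ a → z ≠ b → ψ w ≠ ψ z := by
    intro w z hwz hza hzb
    rw [hψz z hza hzb]
    by_cases hwa : w = a
    · rw [hwa, hψa]
      exact (h1' z hza hzb).1.1.symm
    by_cases hwb : w = b
    · rw [hwb, hψb]
      exact (h1' z hza hzb).1.2.symm
    rw [hψz w hwa hwb]
    exact fun he => hwz (h2 (by simp [hwa, hwb]) (by simp [hza, hzb]) he)
  refine hF ⟨⟨⟨ψ, ?_⟩, ?_⟩⟩
  · intro w z hwz
    by_cases hz : z ≠ a ∧ z ≠ b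
    · exact hψadj w z hwz hz.1 hz.2
    by_cases hw : w ≠ a ∧ w ≠ b
    · exact (hψadj z w hwz.symm hw.1 hw.2).symm
    have hz' : z = a ∨ z = b := by tauto
    have hw' : w = a ∨ w = b := by tauto
    rcases hz' with rfl | rfl <;> rcases hw' with rfl | rfl
    · exact absurd hwz H.irrefl
    · rw [hψa, hψb]; exact hxy.symm
    · rw [hψa, hψb]; exact hxy
    · exact absurd hwz H.irrefl
  · intro w z hwz
    change ψ w = ψ z at hwz
    by_contra hne
    by_cases hz : z ≠ a ∧ z ≠ b
    · exact hψinj w z hne hz.1 hz.2 hwz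
    by_cases hw : w ≠ a ∧ w ≠ b
    · exact hψinj z w (Ne.symm hne) hw.1 hw.2 hwz.symm
    have hz' : z = a ∨ z = b := by tauto
    have hw' : w = a ∨ w = b := by tauto
    rcases hz' with hz' | hz' <;> rcases hw' with hw' | hw'
    · exact hne (hw'.trans hz'.symm)
    · rw [hz', hw', hψa, hψb] at hwz
      exact hxy.ne hwz.symm
    · rw [hz', hw', hψa, hψb] at hwz
      exact hxy.ne hwz
    · exact hne (hw'.trans hz'.symm)

/-! ### Counting ordered pairs, and building cuts vertex by vertex. -/

/-- The number of ordered pairs of elements of `U` related by `R`. -/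
noncomputable def pairCount {V : Type*} (R : V → V → Prop) (U : Finset V) : ℕ :=
  ∑ x ∈ U, #{y ∈ U | R x y}

section PairCount

variable {V : Type*}

theorem pairCount_insert {R : V → V → Prop} (hsymm : ∀ x y, R x y → R y x) {v : V}
    (hirr : ¬ R v v) {U : Finset V} (hv : v ∉ U) {D : Finset V}
    (hD : ∀ u, u ∈ D ↔ u ∈ U ∧ R v u) :
    pairCount R (insert v U) = pairCount R U + 2 * #D := by
  have h1 : ∀ x, #{y ∈ insert v U | R x y} = #{y ∈ U | R x y} + if R x v then 1 else 0 := by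
    intro x
    rw [filter_insert]
    split_ifs with h
    · rw [card_insert_of_notMem fun hm => hv (mem_filter.1 hm).1]
    · rfl
  have h2 : {x ∈ U | R x v} = D := by
    ext x
    rw [mem_filter, hD]
    exact and_congr_right fun _ => ⟨hsymm x v, hsymm v x⟩
  have h3 : {x ∈ U | R v x} = D := by
    ext x
    rw [mem_filter, hD]
  rw [pairCount, sum_insert hv, sum_congr rfl fun x _ => h1 x, sum_add_distrib, h1 v, if_neg hirr,
    ← card_filter, h2, h3, pairCount]
  ring

theorem pairCount_congr {R R' : V → V → Prop} {U : Finset V}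
    (h : ∀ x ∈ U, ∀ y ∈ U, (R x y ↔ R' x y)) : pairCount R U = pairCount R' U :=
  sum_congr rfl fun x hx => congrArg card (filter_congr fun y hy => h x hx y hy)

theorem pairCount_mono {R R' : V → V → Prop} {U : Finset V} (h : ∀ x y, R x y → R' x y) :
    pairCount R U ≤ pairCount R' U :=
  sum_le_sum fun x _ => card_le_card (monotone_filter_right _ fun y _ => h x y)

theorem pairCount_and_add_pairCount_and_not (R P : V → V → Prop) (U : Finset V) :
    pairCount (fun x y => R x y ∧ P x y) U + pairCount (fun x y => R x y ∧ ¬ P x y) U =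
      pairCount R U := by
  rw [pairCount, pairCount, pairCount, ← sum_add_distrib]
  refine sum_congr rfl fun x _ => ?_
  rw [← card_filter_add_card_filter_not (s := {y ∈ U | R x y}) (P x)]
  congr 2 <;> · ext y; simp [and_assoc]

theorem pairCount_le_sq (R : V → V → Prop) (U : Finset V) : pairCount R U ≤ #U * #U := by
  rw [pairCount, ← smul_eq_mul, ← sum_const]
  exact sum_le_sum fun x _ => card_filter_le _ _

theorem pairCount_adj_univ [Fintype V] (F : SimpleGraph V) [Fintype F.edgeSet] :
    pairCount F.Adj univ = 2 * #F.edgeFinset := by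
  have h : pairCount F.Adj univ = ∑ v, F.degree v := by
    rw [pairCount]
    refine sum_congr rfl fun v _ => ?_
    rw [← card_neighborFinset_eq_degree, neighborFinset_eq_filter]
  rw [h]
  convert F.sum_degrees_eq_twice_card_edges

theorem card_filter_coe (U : Finset V) {p : V → Prop} {q : U → Prop} {_ : DecidablePred p}
    {_ : DecidablePred q} (hpq : ∀ u, q u ↔ p u) : #{u : U | q u} = #{u ∈ U | p u} := by
  rw [← card_map (Function.Embedding.subtype (· ∈ U))]
  congr 1
  ext x
  simp [hpq, and_comm]

/-- A colored vertex set can be extended by a vertex such that at most a fraction `1 / r` of the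
new edges is monochromatic. -/
theorem exists_extend_cut {r : ℕ} (hr : 1 ≤ r) (G : SimpleGraph V) {U : Finset V} {v : V}
    (hv : v ∉ U) (f : V → Fin r) :
    ∃ f' : V → Fin r, (pairCount (fun x y => G.Adj x y ∧ ¬ f x = f y) U : ℝ) +
      2 * ((1 - 1 / r) * #{u ∈ U | G.Adj v u}) ≤
      pairCount (fun x y => G.Adj x y ∧ ¬ f' x = f' y) (insert v U) := by
  have hr0 : (0 : ℝ) < r := by exact_mod_cast hr
  -- By averaging, some colour is carried by at most 1/r of the neighbours of `v`; `v` receives it.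
  obtain ⟨i, -, hi⟩ := exists_card_fiber_le_of_card_le_nsmul
    (s := {u ∈ U | G.Adj v u}) (t := (univ : Finset (Fin r))) (f := f)
    (b := (#{u ∈ U | G.Adj v u} : ℝ) / r) ⟨⟨0, hr⟩, mem_univ _⟩ (by
      rw [card_univ, Fintype.card_fin, nsmul_eq_mul]
      exact le_of_eq (by field_simp))
  refine ⟨Function.update f v i, ?_⟩
  have hne : ∀ u ∈ U, u ≠ v := fun u hu h => hv (h ▸ hu)
  have hcongr : pairCount (fun x y => G.Adj x y ∧
      ¬ Function.update f v i x = Function.update f v i y) U =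
      pairCount (fun x y => G.Adj x y ∧ ¬ f x = f y) U :=
    pairCount_congr fun x hx y hy => by
      rw [Function.update_of_ne (hne x hx), Function.update_of_ne (hne y hy)]
  rw [pairCount_insert (fun x y h => ⟨h.1.symm, fun h' => h.2 h'.symm⟩)
    (fun h => h.2 rfl) hv (D := {u ∈ {u ∈ U | G.Adj v u} | ¬ f u = i}) fun u => by
      rw [mem_filter, mem_filter, and_assoc]
      refine and_congr_right fun hu => ?_
      rw [Function.update_self, Function.update_of_ne (hne u hu), eq_comm], hcongr]
  have h2 := card_filter_add_card_filter_not (s := ({u ∈ U | G.Adj v u} : Finset V))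
    (fun u => f u = i)
  have h3 : (#{u ∈ {u ∈ U | G.Adj v u} | f u = i} : ℝ) + #{u ∈ {u ∈ U | G.Adj v u} | ¬ f u = i} =
      #{u ∈ U | G.Adj v u} := by exact_mod_cast h2
  push_cast
  have h4 : (1 - 1 / (r : ℝ)) * #{u ∈ U | G.Adj v u} =
      #{u ∈ U | G.Adj v u} - (#{u ∈ U | G.Adj v u} : ℝ) / r := by ring
  rw [h4]
  linarith

/-- Every graph has an `r`-cut containing a fraction of at least `1 - 1 / r` of the edges. -/
theorem exists_large_cut {r : ℕ} (hr : 1 ≤ r) (G : SimpleGraph V) (U : Finset V) :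
    ∃ f : V → Fin r, (1 - 1 / (r : ℝ)) * pairCount G.Adj U ≤
      pairCount (fun x y => G.Adj x y ∧ ¬ f x = f y) U := by
  induction U using Finset.induction_on with
  | empty => exact ⟨fun _ => ⟨0, hr⟩, by simp [pairCount]⟩
  | insert v U hv ih =>
    obtain ⟨f, hf⟩ := ih
    obtain ⟨f', hf'⟩ := exists_extend_cut hr G hv f
    refine ⟨f', le_trans ?_ hf'⟩
    rw [pairCount_insert (fun _ _ h => h.symm) G.irrefl hv (D := {u ∈ U | G.Adj v u})
      fun u => mem_filter]
    push_cast
    linarith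

/-- If every sufficiently large vertex set on which `Γ` has large minimum degree has a cut in `G`
with almost as many edges as `Γ`, then so does every vertex set on which `Γ` is dense. -/
theorem exists_cut_of_core [Fintype V] {r : ℕ} (hr : 1 ≤ r) {G Γ : SimpleGraph V}
    {ε κ μ M : ℝ} (hε : 0 ≤ ε) (hε' : ε ≤ 1 - 1 / r) (hκ : 0 < κ) (hμ : μ ≤ ε * κ)
    (hdeg : ∀ v, (#{u | ¬ G.Adj v u} : ℝ) ≤ μ * Fintype.card V)
    (hcore : ∀ U : Finset V, κ * Fintype.card V ≤ #U →
      (∀ v ∈ U, (#{u ∈ U | ¬ Γ.Adj v u} : ℝ) ≤ (1 / r + ε) * #U) →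
      ∃ f : V → Fin r, (pairCount Γ.Adj U : ℝ) - M ≤
        pairCount (fun x y => G.Adj x y ∧ ¬ f x = f y) U) (k : ℕ) (U : Finset V) (hU : #U = k)
    (hdense : (1 - 1 / r - ε) * (k * (k + 1)) + κ * (Fintype.card V : ℝ) ^ 2 ≤
      pairCount Γ.Adj U) :
    ∃ f : V → Fin r, (pairCount Γ.Adj U : ℝ) - M ≤
      pairCount (fun x y => G.Adj x y ∧ ¬ f x = f y) U := by
  -- Removing a vertex of `Γ`-degree at most (1 - 1/r - ε)k from a k-set costs at most twice that
  -- many ordered pairs. This is exactly the drop in (1 - 1/r - ε)k(k + 1), so `hdense` persists;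
  -- its term κn² forces k ≥ κn throughout.
  induction k generalizing U with
  | zero =>
    have h0 : U = ∅ := card_eq_zero.1 hU
    -- For k = 0, density reads κn² ≤ 0, so `hcore` applies to the empty set.
    have hn : (Fintype.card V : ℝ) = 0 := by
      have : (pairCount Γ.Adj U : ℝ) = 0 := by rw [h0]; simp [pairCount]
      rw [this] at hdense
      have h2 : κ * (Fintype.card V : ℝ) ^ 2 ≤ 0 := by simpa using hdense
      have h3 : (Fintype.card V : ℝ) ^ 2 ≤ 0 := by
        by_contra! hcon
        have := mul_pos hκ hcon
        linarith
      exact pow_eq_zero_iff (two_ne_zero) |>.1 (le_antisymm h3 (by positivity))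
    exact hcore U (by rw [hn, hU]; simp) (by simp [h0])
  | succ k ih =>
    have hr0 : (0 : ℝ) < r := by exact_mod_cast hr
    set n : ℝ := (Fintype.card V : ℝ) with hn
    have hUn : ((k + 1 : ℕ) : ℝ) ≤ n := by
      rw [← hU, hn]
      exact_mod_cast card_le_univ U
    have hkpos : (0 : ℝ) < ((k + 1 : ℕ) : ℝ) := by positivity
    have hn0 : 0 < n := hkpos.trans_le hUn
    have hlarge : κ * n ≤ ((k + 1 : ℕ) : ℝ) := by
      have h1 : (pairCount Γ.Adj U : ℝ) ≤ ((k + 1 : ℕ) : ℝ) * ((k + 1 : ℕ) : ℝ) := by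
        rw [← hU]
        exact_mod_cast pairCount_le_sq _ _
      have h2 : 0 ≤ (1 - 1 / r - ε) * (((k + 1 : ℕ) : ℝ) * (((k + 1 : ℕ) : ℝ) + 1)) :=
        mul_nonneg (by linarith) (by positivity)
      have h3 : κ * n * n ≤ ((k + 1 : ℕ) : ℝ) * n := by
        have : ((k + 1 : ℕ) : ℝ) * ((k + 1 : ℕ) : ℝ) ≤ ((k + 1 : ℕ) : ℝ) * n := by gcongr
        nlinarith
      exact le_of_mul_le_mul_right h3 hn0
    by_cases hmin : ∀ v ∈ U, (#{u ∈ U | ¬ Γ.Adj v u} : ℝ) ≤ (1 / r + ε) * #U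
    · exact hcore U (by rw [hU]; exact hlarge) hmin
    · push Not at hmin
      obtain ⟨v, hvU, hv⟩ := hmin
      have hins : insert v (U.erase v) = U := insert_erase hvU
      have hve : v ∉ U.erase v := notMem_erase v U
      have hcount := pairCount_insert (R := Γ.Adj) (fun _ _ h => h.symm) Γ.irrefl hve
        (D := {u ∈ U.erase v | Γ.Adj v u}) fun u => mem_filter
      rw [hins] at hcount
      have hcount' : (pairCount Γ.Adj U : ℝ) =
          pairCount Γ.Adj (U.erase v) + 2 * #{u ∈ U.erase v | Γ.Adj v u} := by
        exact_mod_cast hcount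
      have hd1 : (#{u ∈ U.erase v | Γ.Adj v u} : ℝ) ≤ (1 - 1 / r - ε) * ((k + 1 : ℕ) : ℝ) := by
        have h1 : (#{u ∈ U.erase v | Γ.Adj v u} : ℝ) ≤ #{u ∈ U | Γ.Adj v u} := by
          exact_mod_cast card_le_card (filter_subset_filter _ (erase_subset _ _))
        have h2 : (#{u ∈ U | Γ.Adj v u} : ℝ) + #{u ∈ U | ¬ Γ.Adj v u} = ((k + 1 : ℕ) : ℝ) := by
          rw [← hU]
          exact_mod_cast card_filter_add_card_filter_not (s := U) (Γ.Adj v)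
        rw [hU] at hv
        linarith
      have hd2 : ((k + 1 : ℕ) : ℝ) - μ * n ≤ #{u ∈ U.erase v | G.Adj v u} := by
        have h1 : ({u ∈ U.erase v | G.Adj v u} : Finset V) = {u ∈ U | G.Adj v u} := by
          ext u
          simp only [mem_filter, mem_erase]
          exact ⟨fun h => ⟨h.1.2, h.2⟩, fun h => ⟨⟨h.2.ne', h.1⟩, h.2⟩⟩
        have h2 : (#{u ∈ U | G.Adj v u} : ℝ) + #{u ∈ U | ¬ G.Adj v u} = ((k + 1 : ℕ) : ℝ) := by
          rw [← hU]
          exact_mod_cast card_filter_add_card_filter_not (s := U) (G.Adj v)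
        have h3 : (#{u ∈ U | ¬ G.Adj v u} : ℝ) ≤ #{u | ¬ G.Adj v u} := by
          exact_mod_cast card_le_card (filter_subset_filter _ (subset_univ _))
        have h4 := hdeg v
        rw [h1]
        linarith
      obtain ⟨f, hf⟩ := ih (U.erase v) (by rw [card_erase_of_mem hvU, hU]; rfl) (by
        push_cast at hdense hd1 ⊢
        nlinarith)
      obtain ⟨f', hf'⟩ := exists_extend_cut hr G hve f
      rw [hins] at hf'
      refine ⟨f', ?_⟩
      -- As μn ≤ εκn ≤ ε(k + 1), the cut edges gained in `G` by restoring `v` cover the edges `Γ`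
      -- lost.
      have h1 : (1 - 1 / r - ε) * ((k + 1 : ℕ) : ℝ) ≤
          (1 - 1 / (r : ℝ)) * #{u ∈ U.erase v | G.Adj v u} := by
        have h2 : (0 : ℝ) ≤ 1 - 1 / r := by linarith
        have h3 : (1 - 1 / (r : ℝ)) * (((k + 1 : ℕ) : ℝ) - μ * n) ≤
            (1 - 1 / (r : ℝ)) * #{u ∈ U.erase v | G.Adj v u} := by gcongr
        have h4 : μ * n ≤ ε * ((k + 1 : ℕ) : ℝ) := by
          calc μ * n ≤ ε * κ * n := by gcongr
            _ = ε * (κ * n) := by ring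
            _ ≤ _ := by gcongr
        have h5 : (1 - 1 / (r : ℝ)) * (μ * n) ≤ 1 * (ε * ((k + 1 : ℕ) : ℝ)) := by
          have h6 : (0 : ℝ) < 1 / r := by positivity
          have h7 : (1 - 1 / (r : ℝ)) * (μ * n) ≤ (1 - 1 / (r : ℝ)) * (ε * ((k + 1 : ℕ) : ℝ)) := by
            gcongr
          refine h7.trans ?_
          gcongr
          linarith
        linarith
      linarith

end PairCount

/-! ### From cuts to edit distances. -/

/-- Deleting the monochromatic edges makes `f` a proper colouring; the factor 2 reflects ordered
pairs. -/
theorem two_mul_editDistColorable_le {V : Type*} [Fintype V] (G : SimpleGraph V) {r : ℕ}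
    (f : V → Fin r) :
    2 * editDistColorable r G ≤ pairCount (fun x y => G.Adj x y ∧ f x = f y) univ := by
  let M : SimpleGraph V :=
    { Adj := fun x y => G.Adj x y ∧ f x = f y
      symm := ⟨fun x y h => ⟨h.1.symm, h.2.symm⟩⟩
      loopless := ⟨fun x h => G.irrefl h.1⟩ }
  have h1 : editDistColorable r G ≤ #M.edgeFinset := by
    refine Nat.sInf_le ⟨M.edgeFinset, ?_, rfl, ⟨Coloring.mk f ?_⟩⟩
    · rw [coe_edgeFinset]
      exact edgeSet_mono fun x y h => h.1
    · intro x y hxy hf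
      rw [coe_edgeFinset, deleteEdges_adj] at hxy
      exact hxy.2 (mem_edgeSet (G := M) |>.2 ⟨hxy.1, hf⟩)
  have h2 := pairCount_adj_univ M
  change pairCount (fun x y => G.Adj x y ∧ f x = f y) univ = _ at h2
  omega

/-- A copy of `H` in an `r`-colourable graph would pull the colouring back to `H`. -/
theorem editDistFree_le_editDistColorable {V : Type*} {W : Type*} [Finite V] (G : SimpleGraph V)
    {H : SimpleGraph W} {r : ℕ} (hr : 1 ≤ r) (hH : ¬ H.Colorable r) :
    editDistFree H G ≤ editDistColorable r G := by
  obtain ⟨S, hS, hSc, hcol⟩ := editDist_spec (fun G' => G'.Colorable r) (bot_colorable_of_pos hr) G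
  refine Nat.sInf_le ⟨S, hS, hSc, ?_⟩
  rintro ⟨f⟩
  exact hH (hcol.of_hom f.toHom)

set_option maxHeartbeats 800000 in
/-- If `H`-free graphs of large minimum degree are almost `r`-partite, then in graphs of very large
minimum degree the distances to `H`-freeness and to `r`-colorability are almost equal. -/
theorem exists_editDistColorable_le_editDistFree_add {W : Type u} {H : SimpleGraph W} {r : ℕ}
    (hr : 2 ≤ r) (hH : ¬ H.Colorable r) {ε : ℝ} (hε : 0 < ε) {m₀ : ℕ} {b : ℕ → ℝ}
    (hb : Monotone b) (hb0 : ∀ n, 0 ≤ b n)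
    (hmain : ∀ (V : Type v) [Fintype V] (F : SimpleGraph V), m₀ ≤ Fintype.card V → H.Free F →
      (∀ v, (#{u | ¬ F.Adj v u} : ℝ) ≤ (1 / r + ε) * Fintype.card V) →
      ∃ f : V → Fin r, ∑ v, (#{u | F.Adj v u ∧ f v = f u} : ℝ) ≤ b (Fintype.card V)) :
    ∃ μ : ℝ, 0 < μ ∧ ∀ (V : Type v) [Fintype V] (G : SimpleGraph V),
      (∀ v, (#{u | ¬ G.Adj v u} : ℝ) ≤ μ * Fintype.card V) →
      (editDistColorable r G : ℝ) ≤ editDistFree H G + b (Fintype.card V) / 2 := by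
  have hr' : (2 : ℝ) ≤ r := by exact_mod_cast hr
  have hr0 : (0 : ℝ) < r := by linarith
  have hr2 : 1 / (r : ℝ) ≤ 1 / 2 := one_div_le_one_div_of_le (by norm_num) hr'
  have hrpos : 0 < 1 / (r : ℝ) := by positivity
  set ε' : ℝ := min ε (1 / 4) with hε'
  have hε'0 : 0 < ε' := lt_min hε (by norm_num)
  have hε'1 : ε' ≤ ε := min_le_left _ _
  have hε'2 : ε' ≤ 1 / 4 := min_le_right _ _
  set κ : ℝ := ε' / 4 with hκ
  have hκ0 : 0 < κ := by positivity
  -- The first bound serves the peeling; the second ensures m₀ ≤ κn, so the core is large enough for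
  -- `hmain`.
  set μ : ℝ := min (ε' * κ) (κ / (m₀ + 1)) with hμ
  have hμ0 : 0 < μ := lt_min (by positivity) (by positivity)
  have hμ1 : μ ≤ ε' * κ := min_le_left _ _
  have hμ2 : μ * (m₀ + 1) ≤ κ := by
    rw [← le_div_iff₀ (by positivity)]
    exact min_le_right _ _
  refine ⟨μ, hμ0, fun V _ G hdeg => ?_⟩
  rcases isEmpty_or_nonempty V with hV | ⟨⟨v₀⟩⟩
  · have h1 := two_mul_editDistColorable_le G (r := r) (fun v => hV.elim v)
    rw [univ_eq_empty, pairCount, sum_empty] at h1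
    have h2 : editDistColorable r G = 0 := by omega
    rw [h2, Nat.cast_zero]
    have := hb0 (Fintype.card V)
    positivity
  set n : ℝ := (Fintype.card V : ℝ) with hn
  -- Each vertex is its own non-neighbour, so the degree condition itself forces n ≥ 1/μ and small
  -- graphs need no separate treatment.
  have hnμ : 1 ≤ μ * n := by
    refine le_trans ?_ (hdeg v₀)
    exact_mod_cast card_pos.2 ⟨v₀, mem_filter.2 ⟨mem_univ _, G.irrefl⟩⟩
  have hn0 : 0 < n := by
    by_contra! hcon
    have := mul_nonpos_of_nonneg_of_nonpos hμ0.le hcon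
    linarith
  have hm₀n : (m₀ : ℝ) ≤ κ * n := by
    have h1 : μ * (m₀ + 1) * n ≤ κ * n := by gcongr
    have h2 : (m₀ + 1 : ℝ) * 1 ≤ (m₀ + 1) * (μ * n) := by gcongr
    linarith
  obtain ⟨S, hS, hSc, hfree⟩ := editDist_spec (fun G' => H.Free G')
    (free_bot_of_not_colorable fun h => hH (h.mono (by omega))) G
  obtain ⟨Γ, hΓ⟩ : ∃ Γ : SimpleGraph V, Γ = G.deleteEdges (S : Set (Sym2 V)) := ⟨_, rfl⟩
  rw [← hΓ] at hfree
  have hle : Γ ≤ G := hΓ ▸ deleteEdges_le _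
  have hcount : pairCount Γ.Adj univ + 2 * editDistFree H G = pairCount G.Adj univ := by
    rw [pairCount_adj_univ, pairCount_adj_univ]
    have h1 : Γ.edgeFinset = G.edgeFinset \ S := by
      ext e
      simp [hΓ, edgeSet_deleteEdges]
    have h2 : S ⊆ G.edgeFinset := by
      intro e he
      exact mem_edgeFinset.2 (hS he)
    have h3 := card_sdiff_add_card_eq_card h2
    have h4 : #S = editDistFree H G := hSc
    rw [h1]
    omega
  have hcountR : (pairCount Γ.Adj univ : ℝ) + 2 * editDistFree H G = pairCount G.Adj univ := by
    exact_mod_cast hcount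
  have hcore : ∀ U : Finset V, κ * Fintype.card V ≤ #U →
      (∀ v ∈ U, (#{u ∈ U | ¬ Γ.Adj v u} : ℝ) ≤ (1 / r + ε') * #U) →
      ∃ f : V → Fin r, (pairCount Γ.Adj U : ℝ) - b (Fintype.card V) ≤
        pairCount (fun x y => G.Adj x y ∧ ¬ f x = f y) U := by
    intro U hU hUdeg
    obtain ⟨F, hF⟩ : ∃ F : SimpleGraph U, F = Γ.comap Subtype.val := ⟨_, rfl⟩
    have hFadj : ∀ x y, F.Adj x y ↔ Γ.Adj x y := fun x y => by rw [hF]; rfl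
    obtain ⟨f, hf⟩ := hmain U F
      (by
        rw [Fintype.card_coe]
        exact_mod_cast hm₀n.trans hU)
      (fun hc => hfree ((hF ▸ hc).trans
        (Embedding.comap (Function.Embedding.subtype _) Γ).isContained))
      (fun v => by
        rw [Fintype.card_coe]
        rw [card_filter_coe U (q := fun u => ¬ F.Adj v u) (p := fun u => ¬ Γ.Adj v u)
          fun u => not_congr (hFadj v u)]
        refine (hUdeg v v.2).trans ?_
        gcongr)
    refine ⟨fun x => if h : x ∈ U then f ⟨x, h⟩ else ⟨0, by omega⟩, ?_⟩
    set f' : V → Fin r := fun x => if h : x ∈ U then f ⟨x, h⟩ else ⟨0, by omega⟩ with hf'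
    have hff' : ∀ x : U, f x = f' x := fun x => by simp [hf']
    have h1 : ∑ v : U, #{u : U | F.Adj v u ∧ f v = f u} =
        pairCount (fun x y => Γ.Adj x y ∧ f' x = f' y) U := by
      rw [pairCount, ← sum_coe_sort U]
      refine sum_congr rfl fun x _ => ?_
      exact card_filter_coe U fun y => by rw [hFadj, hff', hff']
    have h2 : (pairCount (fun x y => Γ.Adj x y ∧ f' x = f' y) U : ℝ) ≤ b (Fintype.card V) := by
      rw [← h1]
      push_cast
      refine hf.trans (hb ?_)
      rw [Fintype.card_coe]
      exact card_le_univ U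
    have h3 := pairCount_and_add_pairCount_and_not Γ.Adj (fun x y => f' x = f' y) U
    have h4 : pairCount (fun x y => Γ.Adj x y ∧ ¬ f' x = f' y) U ≤
        pairCount (fun x y => G.Adj x y ∧ ¬ f' x = f' y) U :=
      pairCount_mono fun x y h => ⟨hle h.1, h.2⟩
    have h5 : (pairCount Γ.Adj U : ℝ) ≤ pairCount (fun x y => Γ.Adj x y ∧ f' x = f' y) U +
        pairCount (fun x y => G.Adj x y ∧ ¬ f' x = f' y) U := by
      exact_mod_cast (by omega : pairCount Γ.Adj U ≤ _)
    linarith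
  -- Optimality and a large cut give `Γ` a fraction 1 - 1/r of the pairs of `G`. The slack ε'n² pays
  -- for μn², the linear term and κn², each at most ε'n²/4.
  have hdense : (1 - 1 / r - ε') * (Fintype.card V * (Fintype.card V + 1)) +
      κ * (Fintype.card V : ℝ) ^ 2 ≤ pairCount Γ.Adj univ := by
    obtain ⟨f, hf⟩ := exists_large_cut (by omega : 1 ≤ r) G univ
    have h1 : (2 * editDistFree H G : ℝ) ≤ pairCount (fun x y => G.Adj x y ∧ f x = f y) univ := by
      exact_mod_cast (Nat.mul_le_mul_left 2
        (editDistFree_le_editDistColorable G (by omega) hH)).trans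
        (two_mul_editDistColorable_le G f)
    have h2 : (pairCount (fun x y => G.Adj x y ∧ f x = f y) univ : ℝ) +
        pairCount (fun x y => G.Adj x y ∧ ¬ f x = f y) univ = pairCount G.Adj univ := by
      exact_mod_cast pairCount_and_add_pairCount_and_not G.Adj (fun x y => f x = f y) univ
    have h3 : (1 - 1 / (r : ℝ)) * pairCount G.Adj univ ≤ pairCount Γ.Adj univ := by linarith
    have h4 : (1 - μ) * n * n ≤ pairCount G.Adj univ := by
      rw [pairCount]
      push_cast
      have h5 : ∀ v ∈ (univ : Finset V), (1 - μ) * n ≤ (#{u | G.Adj v u} : ℝ) := by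
        intro v _
        have h6 := degree_add_card_not_adj G v
        rw [← card_neighborFinset_eq_degree, neighborFinset_eq_filter] at h6
        have h7 := hdeg v
        linarith
      refine le_trans (le_of_eq ?_) (sum_le_sum h5)
      rw [sum_const, card_univ, nsmul_eq_mul, ← hn]
      ring
    refine le_trans ?_ h3
    have h5 : (1 - 1 / (r : ℝ)) * ((1 - μ) * n * n) ≤ (1 - 1 / (r : ℝ)) * pairCount G.Adj univ := by
      gcongr
      linarith
    refine le_trans ?_ h5
    rw [← hn]
    have hμ3 : μ ≤ ε' / 4 := by nlinarith
    have h6 : n ≤ ε' / 4 * n * n := by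
      have : 1 * n ≤ μ * n * n := by gcongr
      have : μ * n * n ≤ ε' / 4 * n * n := by gcongr
      linarith
    have h7 : (1 - 1 / (r : ℝ)) * (μ * n * n) ≤ 1 * (ε' / 4 * n * n) := by
      gcongr
      linarith
    have h8 : (1 - 1 / (r : ℝ) - ε') * n ≤ 1 * n := by
      gcongr
      linarith
    have h9 : 0 ≤ ε' * n * n := by positivity
    rw [hκ]
    nlinarith
  -- The cut leaves at most 2E'_H + b ordered monochromatic pairs of `G`; halving gives the claim.
  obtain ⟨f, hf⟩ := exists_cut_of_core (by omega : 1 ≤ r) hε'0.le (by linarith) hκ0 hμ1 hdeg hcore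
    (Fintype.card V) univ card_univ hdense
  have h1 : (2 * editDistColorable r G : ℝ) ≤
      pairCount (fun x y => G.Adj x y ∧ f x = f y) univ := by
    exact_mod_cast two_mul_editDistColorable_le G f
  have h2 : (pairCount (fun x y => G.Adj x y ∧ f x = f y) univ : ℝ) +
      pairCount (fun x y => G.Adj x y ∧ ¬ f x = f y) univ = pairCount G.Adj univ := by
    exact_mod_cast pairCount_and_add_pairCount_and_not G.Adj (fun x y => f x = f y) univ
  linarith

theorem card_not_adj_le_of_le_minDegree {V : Type*} [Fintype V] (G : SimpleGraph V)
    [DecidableRel G.Adj] {μ : ℝ}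
    (h : (1 - μ) * (Fintype.card V : ℝ) ≤ (G.minDegree : ℝ)) (v : V) :
    (#{u | ¬ G.Adj v u} : ℝ) ≤ μ * Fintype.card V := by
  have h1 := degree_add_card_not_adj G v
  have h2 : (G.minDegree : ℝ) ≤ G.degree v := by exact_mod_cast G.minDegree_le_degree v
  have h4 : (G.degree v : ℝ) + (#{u | ¬ G.Adj v u} : ℝ) = Fintype.card V := by convert h1
  linarith

end SimpleGraph

/-! ### The theorem. -/

theorem theorem8p1 {W : Type u} [Finite W] (H : SimpleGraph W) (r : ℕ) (hr : 2 ≤ r)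
    (hH : H.chromaticNumber = ((r + 1 : ℕ) : ℕ∞)) :
    (H.HasCriticalEdge →
      ∃ μ : ℝ, 0 < μ ∧
        ∀ (V : Type v) [Fintype V] (G : SimpleGraph V) [DecidableRel G.Adj],
          (1 - μ) * (Fintype.card V : ℝ) ≤ (G.minDegree : ℝ) →
            SimpleGraph.editDistFree H G = SimpleGraph.editDistColorable r G) ∧
    (¬ H.HasCriticalEdge →
      ∃ γ : ℝ, 0 < γ ∧ ∃ μ : ℝ, 0 < μ ∧ ∃ C : ℝ,
        ∀ (V : Type v) [Fintype V] (G : SimpleGraph V) [DecidableRel G.Adj],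
          (1 - μ) * (Fintype.card V : ℝ) ≤ (G.minDegree : ℝ) →
            (SimpleGraph.editDistColorable r G : ℝ) - C * (Fintype.card V : ℝ) ^ (2 - γ)
                ≤ (SimpleGraph.editDistFree H G : ℝ) ∧
              SimpleGraph.editDistFree H G ≤ SimpleGraph.editDistColorable r G) := by
  classical
  have := Fintype.ofFinite W
  have hcol : H.Colorable (r + 1) := SimpleGraph.chromaticNumber_le_iff_colorable.1 hH.le
  have hncol : ¬ H.Colorable r := fun h => by
    have h1 := h.chromaticNumber_le
    rw [hH] at h1
    have : r + 1 ≤ r := by exact_mod_cast h1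
    omega
  constructor
  · rintro ⟨e, he, hlt⟩
    induction e with | _ a b
    have hcrit : (H.deleteEdges {s(a, b)}).Colorable r := by
      refine SimpleGraph.chromaticNumber_le_iff_colorable.1 ?_
      rw [hH] at hlt
      refine Order.le_of_lt_add_one ?_
      exact_mod_cast hlt
    obtain ⟨ε, hε, m₀, hm₀⟩ := SimpleGraph.colorable_of_free_of_critical.{u, v} hr hcol hncol he hcrit
    -- A proper colouring has no monochromatic edges, so the error is 0 and equality results.
    obtain ⟨μ, hμ, hmain⟩ := SimpleGraph.exists_editDistColorable_le_editDistFree_add.{u, v} hr hncol hε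
      (m₀ := m₀) (b := fun _ => 0) monotone_const (fun _ => le_rfl) fun V _ F hm hF hdeg => by
        obtain ⟨f⟩ := hm₀ V F hm hF hdeg
        refine ⟨f, le_of_eq (Finset.sum_eq_zero fun v _ => ?_)⟩
        rw [Nat.cast_eq_zero, Finset.card_eq_zero, Finset.filter_eq_empty_iff]
        exact fun u _ h => f.valid h.1 h.2
    refine ⟨μ, hμ, fun V _ G _ hG => ?_⟩
    refine le_antisymm (SimpleGraph.editDistFree_le_editDistColorable G (by omega) hncol) ?_
    have h1 := hmain V G fun v => by convert SimpleGraph.card_not_adj_le_of_le_minDegree G hG v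
    rw [zero_div, add_zero] at h1
    exact_mod_cast h1
  · intro _
    have hW : 1 ≤ Fintype.card W := by
      by_contra! h0
      have : IsEmpty W := Fintype.card_eq_zero_iff.1 (by omega)
      exact hncol (SimpleGraph.Colorable.of_isEmpty r)
    have hW' : 1 / (Fintype.card W : ℝ) ≤ 1 := by
      rw [div_le_one (by exact_mod_cast hW)]
      exact_mod_cast hW
    obtain ⟨ε, hε, m₀, C, hC, hm₀⟩ := SimpleGraph.BlowupFree.exists_few_monochromatic.{v} hr hW
    obtain ⟨μ, hμ, hmain⟩ := SimpleGraph.exists_editDistColorable_le_editDistFree_add.{u, v} hr hncol hε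
      (m₀ := m₀) (b := fun n => C * (n : ℝ) ^ (2 - 1 / (Fintype.card W : ℝ)))
      (fun m n hmn => by
        have : (m : ℝ) ≤ n := by exact_mod_cast hmn
        dsimp only
        gcongr
        linarith)
      (fun n => by positivity) fun V _ F hm hF hdeg => hm₀ V F hm (hF.blowupFree hcol) hdeg
    -- γ = 1/|W| is the Kővári–Sós–Turán gain; `C` is halved because it bounds ordered pairs.
    refine ⟨1 / Fintype.card W, by positivity, μ, hμ, C / 2, fun V _ G _ hG => ⟨?_,
      SimpleGraph.editDistFree_le_editDistColorable G (by omega) hncol⟩⟩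
    have h1 := hmain V G fun v => by convert SimpleGraph.card_not_adj_le_of_le_minDegree G hG v
    linarith
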